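/- Let $\mathbb B^2$ be the open unit disk of $\mathbb R^2$, let $\mathcal T:\mathbb R^2\to\mathbb R^2$ be a symplectic map, i.e. a $C^1$-diffeomorphism whose Jacobian matrix $J_{\mathcal T}$ satisfies $J_{\mathcal T}^{\intercal}\begin{pmatrix}0&1\\-1&0\end{pmatrix}J_{\mathcal T}=\begin{pmatrix}0&1\\-1&0\end{pmatrix}$ everywhere, and put $\Omega=\mathcal T\mathbb B^2$. Let $\kappa\ge 0$ and let $f$ be a continuous linear functional on $H^1(\Omega)$ (for instance $f\in L^2(\Omega)$, acting by $v\mapsto\int_\Omega fv$). Let $u_{\mathcal T}\in H^1(\Omega)$ be a weak solution of the Robin–Poisson problem $-\Delta u_{\mathcal T}=f$ in $\Omega$, $\partial_n u_{\mathcal T}+\kappa u_{\mathcal T}=0$ on $\partial\Omega$, that is, $$\int_\Omega\nabla u_{\mathcal T}\cdot\nabla\varphi+\kappa\int_{\partial\Omega}u_{\mathcal T}\,\varphi=\langle f,\varphi\rangle\qquad\text{for all }\varphi\in H^1(\Omega),$$ where boundary values are understood as traces and $\partial\Omega$ carries arc length. Set $w=u_{\mathcal T}\circ\mathcal T$, $A=J_{\mathcal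 T}^{-1}J_{\mathcal T}^{-\intercal}$, let $n$ be the outward unit normal to $\mathbb S^1=\partial\mathbb B^2$, and define $\tilde f=f\circ\mathcal T$ by $\langle\tilde f,v\rangle=\langle f,v\circ\mathcal T^{-1}\rangle$ for $v\in H^1(\mathbb B^2)$. Then $\tilde f$ is a continuous linear functional on $H^1(\mathbb B^2)$; if $f$ is given by a function, i.e. $\langle f,v\rangle=\int_\Omega fv$ with $fv$ integrable for all $v\in H^1(\Omega)$, then $\tilde f$ is given in the same sense by the composed function $f\circ\mathcal T$. Moreover $w\in H^1(\mathbb B^2)$, and $w$ attains $$\inf_{v\in H^1(\mathbb B^2)}\left\{\frac12\int_{\mathbb B^2}A\nabla v\cdot\nabla v+\frac\kappa2\int_{\mathbb S^1}|J_{\mathcal T}^{-\intercal}n|\,v^2-\langle\tilde f,v\rangle\right\};$$ equivalently, $w$ satisfies the variational equation $$\int_{\mathbb B^2}A\nabla w\cdot\nabla\varphi+\kappa\int_{\mathbb S^1}|J_{\mathcal T}^{-\intercal}n|\,w\,\varphi=\langle\tilde f,\varphi\rangle\qquad\text{for all }\varphi\in H^1(\mathbb B^2).$$ If $\kappa>0$,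 then $w$ is the only minimizer, up to equality almost everywhere in $\mathbb B^2$. -/

import Mathlib

open MeasureTheory Filter Topology Set
open scoped ContDiff Matrix

noncomputable section

namespace RobinSymp

/-- The Euclidean plane. -/
abbrev Plane : Type := EuclideanSpace ℝ (Fin 2)

/-- The open unit disk. -/
abbrev disk : Set Plane := Metric.ball 0 1

/-! ### Sobolev space `H¹` -/

/-- `g` is the weak gradient of `u` in the open set `Ω`. -/
def IsWeakGrad (Ω : Set Plane) (u : Plane → ℝ) (g : Plane → Plane) : Prop :=
  LocallyIntegrableOn u Ω ∧ LocallyIntegrableOn g Ω ∧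
  ∀ φ : Plane → ℝ, ContDiff ℝ ∞ φ → HasCompactSupport φ → tsupport φ ⊆ Ω →
    ∀ e : Plane, ∫ x in Ω, u x * fderiv ℝ φ x e = - ∫ x in Ω, inner ℝ (g x) e * φ x

/-- `u ∈ H¹(Ω)`; only the values of `u` on `Ω`, up to null sets, matter. -/
def MemH1 (Ω : Set Plane) (u : Plane → ℝ) : Prop :=
  MemLp u 2 (volume.restrict Ω) ∧
  ∃ g : Plane → Plane, MemLp g 2 (volume.restrict Ω) ∧ IsWeakGrad Ω u g

open Classical in
/-- The weak gradient `∇u` in `Ω`, which is unique up to null sets (and `0` if there is none). -/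
def weakGrad (Ω : Set Plane) (u : Plane → ℝ) : Plane → Plane :=
  if h : ∃ g, IsWeakGrad Ω u g then h.choose else 0

/-- The norm of `H¹(Ω)`. -/
def h1Norm (Ω : Set Plane) (u : Plane → ℝ) : ℝ :=
  Real.sqrt ((∫ x in Ω, u x ^ 2) + ∫ x in Ω, ‖weakGrad Ω u x‖ ^ 2)

/-! ### Boundary measure and trace -/

/-- Arc length (one-dimensional Hausdorff measure) on the boundary of `Ω`. -/
def bdry (Ω : Set Plane) : Measure Plane := (μH[1] : Measure Plane).restrict (frontier Ω)

/-- `g ∈ L²(∂Ω)` is the trace of `u` on `∂Ω`: some sequence of functions that are `C¹` on the whole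
plane converges to `u` in `H¹(Ω)`, and its restrictions to `∂Ω` converge to `g` in `L²(∂Ω)`. -/
def IsTrace (Ω : Set Plane) (u : Plane → ℝ) (g : Plane → ℝ) : Prop :=
  MemLp g 2 (bdry Ω) ∧
  ∃ φ : ℕ → Plane → ℝ, (∀ k, ContDiff ℝ 1 (φ k)) ∧
    Tendsto (fun k => eLpNorm (fun x => φ k x - u x) 2 (volume.restrict Ω)) atTop (𝓝 0) ∧
    Tendsto (fun k => eLpNorm (fun x => gradient (φ k) x - weakGrad Ω u x) 2
      (volume.restrict Ω)) atTop (𝓝 0) ∧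
    Tendsto (fun k => eLpNorm (fun x => φ k x - g x) 2 (bdry Ω)) atTop (𝓝 0)

open Classical in
/-- The trace of `u` on `∂Ω`. If `Ω` is a bounded `C¹` domain and `u ∈ H¹(Ω)`, it exists and is
unique up to null sets. -/
def trace (Ω : Set Plane) (u : Plane → ℝ) : Plane → ℝ :=
  if h : ∃ g, IsTrace Ω u g then h.choose else 0

/-! ### Source terms -/

/-- `F` is a continuous linear functional on `H¹(Ω)`. -/
structure IsH1Dual (Ω : Set Plane) (F : (Plane → ℝ) → ℝ) : Prop where
  map_add : ∀ u v, MemH1 Ω u → MemH1 Ω v → F (fun x => u x + v x) = F u + F v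
  map_smul : ∀ (c : ℝ) (u), MemH1 Ω u → F (fun x => c * u x) = c * F u
  bound : ∃ C : ℝ, ∀ u, MemH1 Ω u → |F u| ≤ C * h1Norm Ω u

/-- The functional `F` on `H¹(Ω)` is given by the function `f`, i.e. `⟨F, v⟩ = ∫_Ω f v`. -/
def IsGivenBy (Ω : Set Plane) (F : (Plane → ℝ) → ℝ) (f : Plane → ℝ) : Prop :=
  ∀ v, MemH1 Ω v → IntegrableOn (fun x => f x * v x) Ω ∧ F v = ∫ x in Ω, f x * v x

/-- The source term `f ∘ T` for a functional `f`, where `T` preserves volume: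
`⟨f ∘ T, v⟩ = ⟨f, v ∘ T⁻¹⟩`. -/
def sourceComp (F : (Plane → ℝ) → ℝ) (T : Plane ≃ Plane) : (Plane → ℝ) → ℝ :=
  fun v => F (v ∘ T.symm)

/-! ### Symplectic maps -/

/-- The Jacobian matrix `(∂ⱼ Tᵢ)`. -/
def jac (T : Plane → Plane) (x : Plane) : Matrix (Fin 2) (Fin 2) ℝ :=
  Matrix.of fun i j => (fderiv ℝ T x (EuclideanSpace.single j 1)) i

/-- A symplectic map of the plane: a `C¹`-diffeomorphism whose Jacobian matrix preserves the
standard symplectic form. -/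
structure IsSymplecticMap (T : Plane ≃ Plane) : Prop where
  contDiff : ContDiff ℝ 1 T
  contDiff_symm : ContDiff ℝ 1 T.symm
  symplectic : ∀ x, (jac T x)ᵀ * !![0, 1; -1, 0] * jac T x = !![0, 1; -1, 0]

/-- `A = J_T⁻¹ J_T⁻ᵀ`. -/
def metricTensor (T : Plane → Plane) (x : Plane) : Matrix (Fin 2) (Fin 2) ℝ :=
  (jac T x)⁻¹ * ((jac T x)⁻¹)ᵀ

/-- `|J_T⁻ᵀ n|` at a point `x` of the unit circle, where the outward unit normal is `n = x`. -/
def tangentialJacobian (T : Plane → Plane) (x : Plane) : ℝ :=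
  ‖Matrix.toEuclideanLin ((jac T x)⁻¹)ᵀ x‖

/-! ### The two Robin problems -/

/-- `u ∈ H¹(Ω)` solves `-Δu = F` in `Ω`, `∂ₙu + κ u = 0` on `∂Ω`, in the weak sense. -/
def IsRobinPoissonSolution (Ω : Set Plane) (κ : ℝ) (F : (Plane → ℝ) → ℝ) (u : Plane → ℝ) : Prop :=
  MemH1 Ω u ∧ ∀ φ, MemH1 Ω φ →
    (∫ x in Ω, inner ℝ (weakGrad Ω u x) (weakGrad Ω φ x))
      + κ * (∫ x, trace Ω u x * trace Ω φ x ∂(bdry Ω)) = F φ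

/-- The bilinear form `∫ A∇v·∇φ + κ ∫_{S¹} |J_T⁻ᵀ n| v φ` on `H¹` of the disk. -/
def diskForm (T : Plane → Plane) (κ : ℝ) (v φ : Plane → ℝ) : ℝ :=
  (∫ x in disk, inner ℝ (Matrix.toEuclideanLin (metricTensor T x) (weakGrad disk v x))
      (weakGrad disk φ x))
    + κ * ∫ x, tangentialJacobian T x * (trace disk v x * trace disk φ x) ∂(bdry disk)

/-- The energy `½ ∫ A∇v·∇v + (κ/2) ∫_{S¹} |J_T⁻ᵀ n| v² - ⟨G, v⟩` on `H¹` of the disk. -/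
def diskEnergy (T : Plane → Plane) (κ : ℝ) (G : (Plane → ℝ) → ℝ) (v : Plane → ℝ) : ℝ :=
  (1 / 2) * (∫ x in disk,
      inner ℝ (Matrix.toEuclideanLin (metricTensor T x) (weakGrad disk v x)) (weakGrad disk v x))
    + (κ / 2) * (∫ x, tangentialJacobian T x * trace disk v x ^ 2 ∂(bdry disk))
    - G v

/-- `v` attains the infimum of the energy over `H¹` of the disk. -/
def IsDiskMinimizer (T : Plane → Plane) (κ : ℝ) (G : (Plane → ℝ) → ℝ) (v : Plane → ℝ) : Prop :=
  MemH1 disk v ∧ ∀ v', MemH1 disk v' → diskEnergy T κ G v ≤ diskEnergy T κ G v'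

end RobinSymp

end

open RobinSymp

/-!
Composition with the area-preserving diffeomorphism `T` is a bijection from `H¹(T(𝔹))` onto `H¹(𝔹)`
with `∇(u ∘ T) = J_Tᵀ (∇u ∘ T)`, and it commutes with traces. The factor `A = J_T⁻¹ J_T⁻ᵀ` cancels
the two Jacobians in the Dirichlet integral. On the boundary, `det J_T = 1` makes `|J_T⁻ᵀ n|` equal
to `|J_T τ|` for the unit tangent `τ`, which is the density of arc length under `T` by the area
formula. Hence the form and the energy on the disk are those of the Robin problem on `T(𝔹)`, where
`E(v) = E(u) + ½ a(v - u, v - u)` for a solution `u`; if `κ > 0`, the form `a` is positive definite.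

Weak gradients are carried along as local `L²` limits of gradients (mollification), traces as limits
of `C¹` functions. On the disk, approximation up to the boundary dilates before mollifying, and all
trace estimates come from the identity `∫_{∂𝔹} ψ = ∫_𝔹 (2 ψ + ∂ψ · x)`; the diffeomorphism then
transfers existence and uniqueness of traces to `T(𝔹)`.
-/

namespace RobinSymp

open scoped ENNReal NNReal Convolution

/-! ### Approximation in `Lᵖ` by dilated mollifications -/

section Lp

variable {α ι E : Type*} {mα : MeasurableSpace α} {μ : Measure α} [NormedAddCommGroup E] {p : ℝ≥0∞}

lemma tendsto_eLpNorm_sub {l : Filter ι} (hp : 1 ≤ p) {f g : ι → α → E}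
    (hfm : ∀ i, AEStronglyMeasurable (f i) μ) (hgm : ∀ i, AEStronglyMeasurable (g i) μ)
    (hf : Tendsto (fun i => eLpNorm (f i) p μ) l (𝓝 0))
    (hg : Tendsto (fun i => eLpNorm (g i) p μ) l (𝓝 0)) :
    Tendsto (fun i => eLpNorm (f i - g i) p μ) l (𝓝 0) := by
  have hfg := hf.add hg
  rw [add_zero] at hfg
  exact tendsto_of_tendsto_of_tendsto_of_le_of_le tendsto_const_nhds hfg (fun _ => zero_le)
    fun i => eLpNorm_sub_le (hfm i) (hgm i) hp

lemma eLpNorm_rpow_toReal (hp : 1 ≤ p) (hp' : p ≠ ⊤) (f : α → E) :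
    eLpNorm f p μ ^ p.toReal = ∫⁻ x, ‖f x‖ₑ ^ p.toReal ∂μ := by
  have hp0 : p ≠ 0 := (one_pos.trans_le hp).ne'
  rw [eLpNorm_eq_lintegral_rpow_enorm_toReal hp0 hp', one_div,
    ENNReal.rpow_inv_rpow (ENNReal.toReal_pos hp0 hp').ne']

lemma tendsto_eLpNorm_of_dominated_convergence {l : Filter ι} [l.IsCountablyGenerated]
    (hp : 1 ≤ p) (hp' : p ≠ ⊤) {f : ι → α → E} (hf : ∀ i, AEStronglyMeasurable (f i) μ)
    {bound : α → ℝ} (hbound : MemLp bound p μ) (hle : ∀ᶠ i in l, ∀ᵐ x ∂μ, ‖f i x‖ ≤ bound x)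
    (hlim : ∀ᵐ x ∂μ, Tendsto (fun i => f i x) l (𝓝 0)) :
    Tendsto (fun i => eLpNorm (f i) p μ) l (𝓝 0) := by
  have hp0 : p ≠ 0 := (one_pos.trans_le hp).ne'
  have hpr : 0 < p.toReal := ENNReal.toReal_pos hp0 hp'
  have hint : Tendsto (fun i => ∫⁻ x, ‖f i x‖ₑ ^ p.toReal ∂μ) l (𝓝 (∫⁻ _, 0 ∂μ)) := by
    refine tendsto_lintegral_filter_of_dominated_convergence' (fun x => ‖bound x‖ₑ ^ p.toReal)
      (.of_forall fun i => (hf i).enorm.pow_const _) ?_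
      (lintegral_rpow_enorm_lt_top_of_eLpNorm_lt_top hp0 hp' hbound.2).ne ?_
    · filter_upwards [hle] with i hi
      filter_upwards [hi] with x hx
      gcongr
      exact enorm_le_iff_norm_le.2 (hx.trans (le_abs_self _))
    · filter_upwards [hlim] with x hx
      simpa [Function.comp_def, hpr] using
        ((ENNReal.continuous_rpow_const (y := p.toReal)).tendsto _).comp hx.enorm
  have hroot := ((ENNReal.continuous_rpow_const (y := 1 / p.toReal)).tendsto _).comp hint
  simpa [Function.comp_def, eLpNorm_eq_lintegral_rpow_enorm_toReal hp0 hp', hpr] using hroot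

variable [NormedSpace ℝ E]

lemma enorm_integral_le_eLpNorm [IsProbabilityMeasure μ] (hp : 1 ≤ p) {f : α → E}
    (hf : AEStronglyMeasurable f μ) : ‖∫ x, f x ∂μ‖ₑ ≤ eLpNorm f p μ :=
  calc ‖∫ x, f x ∂μ‖ₑ ≤ ∫⁻ x, ‖f x‖ₑ ∂μ := enorm_integral_le_lintegral_enorm f
    _ = eLpNorm f 1 μ := eLpNorm_one_eq_lintegral_enorm.symm
    _ ≤ eLpNorm f p μ := eLpNorm_le_eLpNorm_of_exponent_le hp hf

/-- Jensen's inequality followed by Tonelli's theorem. -/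
lemma eLpNorm_integral_le {β : Type*} [MeasurableSpace β] [SFinite μ] {ν : Measure β}
    [IsProbabilityMeasure ν] (hp : 1 ≤ p) (hp' : p ≠ ⊤) {F : α → β → E}
    (hF : AEStronglyMeasurable (Function.uncurry F) (μ.prod ν)) {ε : ℝ≥0∞}
    (hε : ∀ᵐ y ∂ν, eLpNorm (fun x => F x y) p μ ≤ ε) :
    eLpNorm (fun x => ∫ y, F x y ∂ν) p μ ≤ ε := by
  have hp0 : 0 < p.toReal := ENNReal.toReal_pos (one_pos.trans_le hp).ne' hp'
  rw [← ENNReal.rpow_le_rpow_iff hp0, eLpNorm_rpow_toReal hp hp']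
  calc ∫⁻ x, ‖∫ y, F x y ∂ν‖ₑ ^ p.toReal ∂μ
      ≤ ∫⁻ x, eLpNorm (F x) p ν ^ p.toReal ∂μ := by
        refine lintegral_mono_ae ?_
        filter_upwards [hF.prodMk_left] with x hx
        gcongr
        exact enorm_integral_le_eLpNorm hp hx
    _ = ∫⁻ x, ∫⁻ y, ‖F x y‖ₑ ^ p.toReal ∂ν ∂μ := by simp only [eLpNorm_rpow_toReal hp hp']
    _ = ∫⁻ y, ∫⁻ x, ‖F x y‖ₑ ^ p.toReal ∂μ ∂ν :=
        lintegral_lintegral_swap (hF.enorm.pow_const _)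
    _ ≤ ∫⁻ _, ε ^ p.toReal ∂ν := by
        refine lintegral_mono_ae (hε.mono fun y hy => ?_)
        rw [← eLpNorm_rpow_toReal hp hp']
        gcongr
    _ = ε ^ p.toReal := by simp

end Lp

section Mollify

variable {G E ι : Type*} [NormedAddCommGroup G] [NormedSpace ℝ G] [NormedAddCommGroup E]

lemma norm_comp_smul_sub_sub_le_indicator {c : G → E} {R M : ℝ}
    (hR : ∀ x, R < ‖x‖ → c x = 0) (hM : ∀ x, ‖c x‖ ≤ M) {r : ℝ} (hr : 1 / 2 < r) {y : G}
    (hy : ‖y‖ < 1) (x : G) :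
    ‖c (r • x - y) - c x‖
      ≤ (Metric.closedBall (0 : G) (2 * (|R| + 1))).indicator (fun _ => M + M) x := by
  by_cases hx : x ∈ Metric.closedBall (0 : G) (2 * (|R| + 1))
  · rw [indicator_of_mem hx]
    exact (norm_sub_le _ _).trans (add_le_add (hM _) (hM _))
  · have hx' : 2 * (|R| + 1) < ‖x‖ := by simpa using hx
    have hRabs := le_abs_self R
    have hfar : R < ‖r • x - y‖ := by
      have := norm_sub_norm_le (r • x) y
      rw [norm_smul, Real.norm_of_nonneg (by linarith)] at this
      nlinarith [abs_nonneg R]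
    simp [hx, hR _ hfar, hR x (by linarith [abs_nonneg R])]

variable [MeasurableSpace G] [BorelSpace G]

lemma measurableEmbedding_smul_sub {r : ℝ} (hr : r ≠ 0) (y : G) :
    MeasurableEmbedding fun x : G => r • x - y :=
  ((Homeomorph.smulOfNeZero r hr).trans (Homeomorph.subRight y)).measurableEmbedding

variable [FiniteDimensional ℝ G] {μ : Measure G} [μ.IsAddHaarMeasure] {p : ℝ≥0∞}

lemma map_smul_sub {r : ℝ} (hr : r ≠ 0) (y : G) :
    μ.map (fun x => r • x - y) = ENNReal.ofReal |(r ^ Module.finrank ℝ G)⁻¹| • μ := by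
  change μ.map ((fun x => x - y) ∘ (r • ·)) = _
  rw [← Measure.map_map (g := fun x => x - y) (by fun_prop) (measurable_const_smul r),
    Measure.map_addHaar_smul μ hr, Measure.map_smul, (measurePreserving_sub_right μ y).map_eq]

lemma eLpNorm_comp_smul_sub (hp : p ≠ ⊤) {r : ℝ} (hr : r ≠ 0) (y : G) (h : G → E) :
    eLpNorm (fun x => h (r • x - y)) p μ
      = ENNReal.ofReal |(r ^ Module.finrank ℝ G)⁻¹| ^ (1 / p).toReal * eLpNorm h p μ := by
  rw [← smul_eq_mul, ← eLpNorm_smul_measure_of_ne_top hp, ← map_smul_sub hr y,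
    (measurableEmbedding_smul_sub hr y).eLpNorm_map_measure]
  rfl

lemma tendsto_eLpNorm_comp_smul_sub_of_continuous (hp : 1 ≤ p) (hp' : p ≠ ⊤) {c : G → E}
    (hc : Continuous c) (hcs : HasCompactSupport c) :
    Tendsto (fun q : ℝ × G => eLpNorm (fun x => c (q.1 • x - q.2) - c x) p μ)
      (𝓝 (1, 0)) (𝓝 0) := by
  obtain ⟨M, hM⟩ := hcs.exists_bound_of_continuous hc
  obtain ⟨R, hR⟩ := hcs.isCompact.isBounded.subset_closedBall (0 : G)
  have hc0 : ∀ x, R < ‖x‖ → c x = 0 := fun x hx => by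
    by_contra h
    exact absurd (hR (subset_tsupport c h)) (by simpa using hx)
  have hnear : ∀ᶠ q : ℝ × G in 𝓝 (1, 0), 1 / 2 < q.1 ∧ ‖q.2‖ < 1 :=
    ((continuous_fst.tendsto (1, 0)).eventually_const_lt (by norm_num)).and
      ((continuous_snd.norm.tendsto (1, 0)).eventually_lt_const (by simp))
  refine tendsto_eLpNorm_of_dominated_convergence hp hp' (fun q => ?_)
    (memLp_indicator_const p (s := Metric.closedBall 0 (2 * (|R| + 1)))
      Metric.isClosed_closedBall.measurableSet (M + M) (Or.inr measure_closedBall_lt_top.ne)) ?_ ?_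
  · exact Continuous.aestronglyMeasurable (by fun_prop)
  · filter_upwards [hnear] with q hq
    exact .of_forall (norm_comp_smul_sub_sub_le_indicator hc0 hM hq.1 hq.2)
  · refine .of_forall fun x => ?_
    have hcont : Continuous fun q : ℝ × G => c (q.1 • x - q.2) - c x := by fun_prop
    simpa using hcont.tendsto (1, 0)

section BumpMeasure

variable [HasContDiffBump G]

/-- The probability measure whose density is the normalized bump function `b`. -/
noncomputable def bumpMeasure (μ : Measure G) (b : ContDiffBump (0 : G)) : Measure G :=
  μ.withDensity fun y => ENNReal.ofReal (b.normed μ y)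

instance (b : ContDiffBump (0 : G)) : IsProbabilityMeasure (bumpMeasure μ b) :=
  ⟨by rw [bumpMeasure, withDensity_apply _ .univ, Measure.restrict_univ,
    ← ofReal_integral_eq_lintegral_ofReal b.integrable_normed (.of_forall b.nonneg_normed),
    b.integral_normed, ENNReal.ofReal_one]⟩

lemma ae_bumpMeasure_norm_lt (b : ContDiffBump (0 : G)) : ∀ᵐ y ∂bumpMeasure μ b, ‖y‖ < b.rOut := by
  rw [bumpMeasure, ae_withDensity_iff b.continuous_normed.measurable.ennreal_ofReal]
  refine .of_forall fun y hy => ?_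
  have hy' : y ∈ Function.support (b.normed μ) := fun h => hy (by rw [h, ENNReal.ofReal_zero])
  simpa [b.support_normed_eq] using hy'

end BumpMeasure

variable [NormedSpace ℝ E]

lemma tendsto_eLpNorm_comp_smul_sub (hp : 1 ≤ p) (hp' : p ≠ ⊤) {h : G → E} (hh : MemLp h p μ) :
    Tendsto (fun q : ℝ × G => eLpNorm (fun x => h (q.1 • x - q.2) - h x) p μ)
      (𝓝 (1, 0)) (𝓝 0) := by
  rw [ENNReal.tendsto_nhds_zero]
  intro ε hε
  have hε4 : ε / 4 ≠ 0 := by simp [hε.ne']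
  obtain ⟨c, hcs, hhc, hc, hcp⟩ := hh.exists_hasCompactSupport_eLpNorm_sub_le hp' hε4
  have hscale : ∀ᶠ q : ℝ × G in 𝓝 (1, 0), q.1 ≠ 0 ∧
      ENNReal.ofReal |(q.1 ^ Module.finrank ℝ G)⁻¹| ^ (1 / p).toReal < 2 := by
    have hcont : ContinuousAt (fun q : ℝ × G =>
        ENNReal.ofReal |(q.1 ^ Module.finrank ℝ G)⁻¹| ^ (1 / p).toReal) (1, 0) := by
      refine ENNReal.continuous_rpow_const.continuousAt.comp
        (ENNReal.continuous_ofReal.continuousAt.comp ?_)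
      exact ((continuous_fst.continuousAt.pow _).inv₀ (by simp)).abs
    exact (continuous_fst.continuousAt.eventually_ne one_ne_zero).and
      (hcont.eventually_lt_const (by simp))
  filter_upwards [hscale, (ENNReal.tendsto_nhds_zero.1
    (tendsto_eLpNorm_comp_smul_sub_of_continuous (μ := μ) hp hp' hc hcs)) (ε / 4)
    (pos_iff_ne_zero.2 hε4)] with q ⟨hq0, hq2⟩ hqc
  have hdil : eLpNorm (fun x => (h - c) (q.1 • x - q.2)) p μ ≤ 2 * (ε / 4) := by
    rw [eLpNorm_comp_smul_sub hp' hq0]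
    gcongr
  have hdm : AEStronglyMeasurable (fun x => (h - c) (q.1 • x - q.2)) μ :=
    (hh.sub hcp).1.comp_quasiMeasurePreserving
      ((measurePreserving_sub_right μ _).quasiMeasurePreserving.comp
        (Measure.quasiMeasurePreserving_smul μ hq0))
  have hsplit : (fun x => h (q.1 • x - q.2) - h x) = (fun x => (h - c) (q.1 • x - q.2))
      + (fun x => c (q.1 • x - q.2) - c x) - (h - c) := by
    ext x
    simp only [Pi.add_apply, Pi.sub_apply]
    abel
  rw [hsplit]
  have hcm : AEStronglyMeasurable (fun x => c (q.1 • x - q.2) - c x) μ :=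
    Continuous.aestronglyMeasurable (by fun_prop)
  calc _ ≤ 2 * (ε / 4) + ε / 4 + ε / 4 :=
        (eLpNorm_sub_le (hdm.add hcm) (hh.sub hcp).1 hp).trans
          (add_le_add ((eLpNorm_add_le hdm hcm hp).trans (add_le_add hdil hqc)) hhc)
    _ = 4 * (ε / 4) := by ring
    _ = ε := ENNReal.mul_div_cancel (by norm_num) (by norm_num)

variable [HasContDiffBump G]

/-- The mollification of `h` by the normalized bump function `b`. -/
noncomputable def mollify (μ : Measure G) (b : ContDiffBump (0 : G)) (h : G → E) : G → E :=
  b.normed μ ⋆[ContinuousLinearMap.lsmul ℝ ℝ, μ] h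

lemma contDiff_mollify (b : ContDiffBump (0 : G)) {h : G → E} (hh : LocallyIntegrable h μ)
    {n : ℕ∞} : ContDiff ℝ n (mollify μ b h) :=
  b.hasCompactSupport_normed.contDiff_convolution_left _ b.contDiff_normed hh

variable [CompleteSpace E]

lemma mollify_sub_const (b : ContDiffBump (0 : G)) {h : G → E} (hh : LocallyIntegrable h μ)
    (x : G) (c : E) : mollify μ b h x - c = ∫ y, (h (x - y) - c) ∂bumpMeasure μ b := by
  have hint : Integrable (fun y => b.normed μ y • h (x - y)) μ :=
    b.hasCompactSupport_normed.convolutionExists_left (ContinuousLinearMap.lsmul ℝ ℝ)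
      b.continuous_normed hh x
  rw [bumpMeasure, integral_withDensity_eq_integral_toReal_smul
    b.continuous_normed.measurable.ennreal_ofReal (by simp)]
  simp only [ENNReal.toReal_ofReal (b.nonneg_normed _), smul_sub]
  rw [integral_sub hint (b.integrable_normed.smul_const c), integral_smul_const,
    b.integral_normed, one_smul]
  rfl

lemma eLpNorm_mollify_comp_smul_sub_le (hp : 1 ≤ p) (hp' : p ≠ ⊤) (b : ContDiffBump (0 : G))
    {h : G → E} (hh : LocallyIntegrable h μ) {r : ℝ} (hr : r ≠ 0) {ε : ℝ≥0∞}
    (hε : ∀ y, ‖y‖ < b.rOut → eLpNorm (fun x => h (r • x - y) - h x) p μ ≤ ε) :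
    eLpNorm (fun x => mollify μ b h (r • x) - h x) p μ ≤ ε := by
  simp only [mollify_sub_const b hh]
  refine eLpNorm_integral_le (F := fun x y => h (r • x - y) - h x) hp hp'
    (AEStronglyMeasurable.sub ?_ ?_) ((ae_bumpMeasure_norm_lt b).mono hε)
  · have hmap : Measure.QuasiMeasurePreserving (fun z : G × G => r • z.1 - z.2)
        (μ.prod (bumpMeasure μ b)) μ :=
      QuasiMeasurePreserving.prod_of_left (by fun_prop) (.of_forall fun y =>
        (measurePreserving_sub_right μ y).quasiMeasurePreserving.comp
          (Measure.quasiMeasurePreserving_smul μ hr))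
    exact AEStronglyMeasurable.comp_quasiMeasurePreserving (g := h) hh.aestronglyMeasurable hmap
  · exact hh.aestronglyMeasurable.comp_fst

lemma tendsto_eLpNorm_mollify_comp_smul_sub {l : Filter ι} (hp : 1 ≤ p)
    (hp' : p ≠ ⊤) {b : ι → ContDiffBump (0 : G)} (hb : Tendsto (fun i => (b i).rOut) l (𝓝 0))
    {r : ι → ℝ} (hr : Tendsto r l (𝓝 1)) {h : G → E} (hh : MemLp h p μ) :
    Tendsto (fun i => eLpNorm (fun x => mollify μ (b i) h (r i • x) - h x) p μ) l (𝓝 0) := by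
  rw [ENNReal.tendsto_nhds_zero]
  intro ε hε
  have hev := ENNReal.tendsto_nhds_zero.1 (tendsto_eLpNorm_comp_smul_sub hp hp' hh) ε hε
  rw [nhds_prod_eq, eventually_prod_iff] at hev
  obtain ⟨P, hP, Q, hQ, hPQ⟩ := hev
  obtain ⟨δ, hδ, hδQ⟩ := Metric.eventually_nhds_iff.1 hQ
  filter_upwards [hr.eventually hP, hr.eventually_ne one_ne_zero,
    hb.eventually_lt_const hδ] with i hri hri0 hbi
  refine eLpNorm_mollify_comp_smul_sub_le hp hp' _ (hh.locallyIntegrable hp) hri0 fun y hy => ?_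
  exact hPQ hri (hδQ (by simpa using hy.trans hbi))

end Mollify

/-! ### Weak gradients -/

section WeakGradient

variable {Ω : Set Plane} {u v : Plane → ℝ} {g h : Plane → Plane}

lemma integrable_smul_of_locallyIntegrableOn {X E : Type*} [TopologicalSpace X] [T2Space X]
    [MeasurableSpace X] [OpensMeasurableSpace X] {μ : Measure X} [NormedAddCommGroup E]
    [NormedSpace ℝ E] {s : Set X} {f : X → E} (hf : LocallyIntegrableOn f s μ) {φ : X → ℝ}
    (hφ : Continuous φ) (hc : HasCompactSupport φ) (hs : tsupport φ ⊆ s) :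
    Integrable (fun x => φ x • f x) μ := by
  have hK : IntegrableOn (fun x => φ x • f x) (tsupport φ) μ :=
    (hf.integrableOn_compact_subset hs hc).continuousOn_smul hφ.continuousOn hc
  exact hK.integrable_of_forall_notMem_eq_zero fun x hx => by
    rw [image_eq_zero_of_notMem_tsupport hx, zero_smul]

namespace IsWeakGrad

section TestFunction

variable {φ : Plane → ℝ}

lemma integrableOn_mul_fderiv (hg : IsWeakGrad Ω u g) (hφ : ContDiff ℝ ∞ φ)
    (hc : HasCompactSupport φ) (hs : tsupport φ ⊆ Ω) (e : Plane) :
    IntegrableOn (fun x => u x * fderiv ℝ φ x e) Ω := by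
  have hint := integrable_smul_of_locallyIntegrableOn hg.1
    ((hφ.continuous_fderiv_apply (by simp)).comp (.prodMk_left e)) (hc.fderiv_apply ℝ e)
    ((tsupport_fderiv_apply_subset ℝ e).trans hs)
  exact (hint.congr (.of_forall fun x => mul_comm _ _)).integrableOn

lemma integrable_smul (hg : IsWeakGrad Ω u g) (hφ : ContDiff ℝ ∞ φ) (hc : HasCompactSupport φ)
    (hs : tsupport φ ⊆ Ω) : Integrable fun x => φ x • g x :=
  integrable_smul_of_locallyIntegrableOn hg.2.1 hφ.continuous hc hs

lemma integrableOn_inner_mul (hg : IsWeakGrad Ω u g) (hφ : ContDiff ℝ ∞ φ)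
    (hc : HasCompactSupport φ) (hs : tsupport φ ⊆ Ω) (e : Plane) :
    IntegrableOn (fun x => inner ℝ (g x) e * φ x) Ω := by
  refine (((hg.integrable_smul hφ hc hs).inner_const (𝕜 := ℝ) e).congr
    (.of_forall fun x => ?_)).integrableOn
  simp only [real_inner_smul_left, mul_comm]

end TestFunction

lemma sub (hu : IsWeakGrad Ω u g) (hv : IsWeakGrad Ω v h) : IsWeakGrad Ω (u - v) (g - h) := by
  refine ⟨hu.1.sub hv.1, hu.2.1.sub hv.2.1, fun φ hφ hc hs e => ?_⟩
  simp only [Pi.sub_apply, sub_mul, inner_sub_left]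
  rw [integral_sub (hu.integrableOn_mul_fderiv hφ hc hs e) (hv.integrableOn_mul_fderiv hφ hc hs e),
    integral_sub (hu.integrableOn_inner_mul hφ hc hs e) (hv.integrableOn_inner_mul hφ hc hs e),
    hu.2.2 φ hφ hc hs e, hv.2.2 φ hφ hc hs e]
  ring

lemma ae_eq_zero (hΩ : IsOpen Ω) (hg : IsWeakGrad Ω 0 g) : g =ᵐ[volume.restrict Ω] 0 := by
  rw [EventuallyEq, ae_restrict_iff' hΩ.measurableSet]
  refine hΩ.ae_eq_zero_of_integral_contDiff_smul_eq_zero hg.2.1 fun φ hφ hc hs => ?_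
  refine ext_inner_left ℝ fun e => ?_
  have hsupp : ∀ x ∉ Ω, inner ℝ e (φ x • g x) = 0 := fun x hx => by
    rw [image_eq_zero_of_notMem_tsupport fun hx' => hx (hs hx'), zero_smul, inner_zero_right]
  rw [← integral_inner (hg.integrable_smul hφ hc hs),
    ← setIntegral_eq_integral_of_forall_compl_eq_zero hsupp, inner_zero_right]
  simpa [real_inner_smul_right, real_inner_comm, mul_comm] using (hg.2.2 φ hφ hc hs e).symm

lemma ae_eq (hΩ : IsOpen Ω) (hg : IsWeakGrad Ω u g) (hh : IsWeakGrad Ω u h) :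
    g =ᵐ[volume.restrict Ω] h := by
  have hsub := hg.sub hh
  rw [sub_self] at hsub
  exact (hsub.ae_eq_zero hΩ).mono fun x hx => sub_eq_zero.1 hx

lemma weakGrad (hg : IsWeakGrad Ω u g) : IsWeakGrad Ω u (weakGrad Ω u) := by
  have hex : ∃ g, IsWeakGrad Ω u g := ⟨g, hg⟩
  rw [RobinSymp.weakGrad, dif_pos hex]
  exact hex.choose_spec

lemma ae_eq_weakGrad (hΩ : IsOpen Ω) (hg : IsWeakGrad Ω u g) :
    RobinSymp.weakGrad Ω u =ᵐ[volume.restrict Ω] g :=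
  hg.weakGrad.ae_eq hΩ hg

end IsWeakGrad

namespace MemH1

lemma isWeakGrad (hu : MemH1 Ω u) : IsWeakGrad Ω u (weakGrad Ω u) :=
  hu.2.choose_spec.2.weakGrad

lemma memLp_weakGrad (hΩ : IsOpen Ω) (hu : MemH1 Ω u) :
    MemLp (weakGrad Ω u) 2 (volume.restrict Ω) := by
  obtain ⟨-, g, hg2, hg⟩ := hu
  exact (memLp_congr_ae (hg.ae_eq_weakGrad hΩ)).2 hg2

lemma sub (hu : MemH1 Ω u) (hv : MemH1 Ω v) : MemH1 Ω (u - v) := by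
  obtain ⟨hu2, g, hg2, hg⟩ := hu
  obtain ⟨hv2, h, hh2, hh⟩ := hv
  exact ⟨hu2.sub hv2, _, hg2.sub hh2, hg.sub hh⟩

lemma weakGrad_sub (hΩ : IsOpen Ω) (hu : MemH1 Ω u) (hv : MemH1 Ω v) :
    weakGrad Ω (u - v) =ᵐ[volume.restrict Ω] weakGrad Ω u - weakGrad Ω v :=
  (hu.isWeakGrad.sub hv.isWeakGrad).ae_eq_weakGrad hΩ

end MemH1

end WeakGradient

/-! ### Weak gradients and mollification -/

section Mollify

lemma fderiv_comp_const_sub {E F : Type*} [NormedAddCommGroup E] [NormedSpace ℝ E]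
    [NormedAddCommGroup F] [NormedSpace ℝ F] (f : E → F) (x y : E) :
    fderiv ℝ (fun z => f (x - z)) y = -fderiv ℝ f (x - y) := by
  have hneg := (ContinuousLinearEquiv.neg ℝ (M := E)).comp_right_fderiv (f := fun z => f (x + z))
    (x := y)
  ext e
  simpa [Function.comp_def, fderiv_comp_add_left, ← sub_eq_add_neg] using
    DFunLike.congr_fun hneg e

section Haar

variable {G E : Type*} [NormedAddCommGroup G] [NormedSpace ℝ G] [MeasurableSpace G]
  [BorelSpace G] [FiniteDimensional ℝ G] [HasContDiffBump G] {μ : Measure G} [μ.IsAddHaarMeasure]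
  [NormedAddCommGroup E] [NormedSpace ℝ E] (b : ContDiffBump (0 : G)) {h : G → E}

lemma tsupport_normed_const_sub_subset (x : G) :
    tsupport (fun y => b.normed μ (x - y)) ⊆ Metric.closedBall x b.rOut := by
  refine closure_minimal (fun y hy => ?_) Metric.isClosed_closedBall
  have hxy : x - y ∈ Function.support (b.normed μ) := hy
  rw [b.support_normed_eq, mem_ball_zero_iff] at hxy
  rw [Metric.mem_closedBall', dist_eq_norm]
  exact hxy.le

lemma mollify_apply (x : G) : mollify μ b h x = ∫ y, b.normed μ (x - y) • h y ∂μ :=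
  convolution_eq_swap _

lemma fderiv_mollify_apply (hh : LocallyIntegrable h μ) (x e : G) :
    fderiv ℝ (mollify μ b h) x e = ∫ y, fderiv ℝ (b.normed μ) (x - y) e • h y ∂μ := by
  have hρ : ContDiff ℝ 1 (b.normed μ) := b.contDiff_normed
  have hρc : HasCompactSupport (b.normed μ) := b.hasCompactSupport_normed
  have hder := hρc.hasFDerivAt_convolution_right (ContinuousLinearMap.lsmul ℝ ℝ).flip hh hρ x
  rw [mollify, ← convolution_flip, hder.fderiv, convolution_precompR_apply _ hh (hρc.fderiv ℝ)
    (hρ.continuous_fderiv one_ne_zero)]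
  rfl

end Haar

variable {Ω : Set Plane} {u : Plane → ℝ} {g : Plane → Plane}

lemma IsWeakGrad.gradient_mollify_indicator (hΩ : MeasurableSet Ω) (hg : IsWeakGrad Ω u g)
    (hu : LocallyIntegrable (Ω.indicator u)) (hg' : LocallyIntegrable (Ω.indicator g))
    (b : ContDiffBump (0 : Plane)) {x : Plane} (hx : Metric.closedBall x b.rOut ⊆ Ω) :
    gradient (mollify volume b (Ω.indicator u)) x = mollify volume b (Ω.indicator g) x := by
  set ψ : Plane → ℝ := fun y => b.normed volume (x - y)
  have hψ : ContDiff ℝ ∞ ψ := b.contDiff_normed.comp (contDiff_const.sub contDiff_id)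
  have hψs := tsupport_normed_const_sub_subset (μ := volume) b x
  have hψc : HasCompactSupport ψ :=
    (isCompact_closedBall x b.rOut).of_isClosed_subset (isClosed_tsupport _) hψs
  refine ext_inner_left ℝ fun e => ?_
  calc inner ℝ e (gradient (mollify volume b (Ω.indicator u)) x)
      = ∫ y, fderiv ℝ (b.normed volume) (x - y) e • Ω.indicator u y := by
        rw [inner_gradient_right, fderiv_mollify_apply b hu, conj_trivial]
    _ = ∫ y, Ω.indicator (fun y => -(u y * fderiv ℝ ψ y e)) y := by
        congr with y
        by_cases hy : y ∈ Ω <;> simp [hy, ψ, fderiv_comp_const_sub, mul_comm]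
    _ = ∫ y in Ω, inner ℝ (g y) e * ψ y := by
        rw [integral_indicator hΩ, integral_neg, hg.2.2 ψ hψ hψc (hψs.trans hx) e, neg_neg]
    _ = ∫ y, inner ℝ e (ψ y • Ω.indicator g y) := by
        rw [← integral_indicator hΩ]
        congr with y
        by_cases hy : y ∈ Ω <;> simp [hy, real_inner_smul_right, real_inner_comm, mul_comm]
    _ = inner ℝ e (mollify volume b (Ω.indicator g) x) := by
        rw [mollify_apply, integral_inner]
        exact hg'.integrable_smul_left_of_hasCompactSupport hψ.continuous hψc

end Mollify

section L2

variable {α ι E : Type*} {mα : MeasurableSpace α} {μ : Measure α} [NormedAddCommGroup E]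
  [InnerProductSpace ℝ E]

lemma inner_toLp {f g : α → E} (hf : MemLp f 2 μ) (hg : MemLp g 2 μ) :
    inner ℝ hf.toLp hg.toLp = ∫ x, inner ℝ (f x) (g x) ∂μ := by
  rw [L2.inner_def]
  refine integral_congr_ae ?_
  filter_upwards [hf.coeFn_toLp, hg.coeFn_toLp] with x hfx hgx
  rw [hfx, hgx]

lemma integrable_inner {f g : α → E} (hf : MemLp f 2 μ) (hg : MemLp g 2 μ) :
    Integrable (fun x => inner ℝ (f x) (g x)) μ := by
  refine (L2.integrable_inner (𝕜 := ℝ) hf.toLp hg.toLp).congr ?_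
  filter_upwards [hf.coeFn_toLp, hg.coeFn_toLp] with x hfx hgx
  rw [hfx, hgx]

lemma tendsto_integral_inner {l : Filter ι} {f g : ι → α → E} {f₀ g₀ : α → E}
    (hf : ∀ i, MemLp (f i) 2 μ) (hf₀ : MemLp f₀ 2 μ) (hg : ∀ i, MemLp (g i) 2 μ)
    (hg₀ : MemLp g₀ 2 μ) (hlim : Tendsto (fun i => eLpNorm (f i - f₀) 2 μ) l (𝓝 0))
    (hlim' : Tendsto (fun i => eLpNorm (g i - g₀) 2 μ) l (𝓝 0)) :
    Tendsto (fun i => ∫ x, inner ℝ (f i x) (g i x) ∂μ) l (𝓝 (∫ x, inner ℝ (f₀ x) (g₀ x) ∂μ)) := by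
  simp only [← inner_toLp (hf _) (hg _), ← inner_toLp hf₀ hg₀]
  exact ((Lp.tendsto_Lp_iff_tendsto_eLpNorm'' _ hf _ hf₀).2 hlim).inner
    ((Lp.tendsto_Lp_iff_tendsto_eLpNorm'' _ hg _ hg₀).2 hlim')

end L2

section Bounded

variable {X E : Type*} [PseudoMetricSpace X] [ProperSpace X] [NormedAddCommGroup E] {f : X → E}
  {s : Set X}

lemma exists_norm_le_of_isBounded (hf : Continuous f) (hs : Bornology.IsBounded s) :
    ∃ C, ∀ x ∈ s, ‖f x‖ ≤ C :=
  (hs.isCompact_closure.exists_bound_of_continuousOn hf.continuousOn).imp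
    fun _ hC x hx => hC x (subset_closure hx)

variable [SecondCountableTopologyEither X E] [MeasurableSpace X] [BorelSpace X] {μ : Measure X}
  [IsFiniteMeasureOnCompacts μ] {p : ℝ≥0∞}

lemma memLp_restrict_of_isBounded (hf : Continuous f) (hs : Bornology.IsBounded s) :
    MemLp f p (μ.restrict s) := by
  have hK := hs.isCompact_closure
  have : IsFiniteMeasure (μ.restrict (closure s)) := ⟨by simpa using hK.measure_lt_top⟩
  obtain ⟨C, hC⟩ := exists_norm_le_of_isBounded hf hs.closure
  refine (MemLp.of_bound hf.aestronglyMeasurable C ?_).mono_measure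
    (Measure.restrict_mono subset_closure le_rfl)
  exact ae_restrict_of_forall_mem isClosed_closure.measurableSet hC

end Bounded

/-! ### Weak gradients as limits of gradients -/

section Friedrichs

/-- Bump functions whose supports shrink to the origin. -/
noncomputable def bumpSeq (k : ℕ) : ContDiffBump (0 : Plane) where
  rIn := 1 / ((k : ℝ) + 1) / 2
  rOut := 1 / ((k : ℝ) + 1)
  rIn_pos := by positivity
  rIn_lt_rOut := half_lt_self (by positivity)

lemma tendsto_bumpSeq_rOut : Tendsto (fun k => (bumpSeq k).rOut) atTop (𝓝 0) :=
  tendsto_one_div_add_atTop_nhds_zero_nat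

variable {Ω : Set Plane}

lemma tendsto_eLpNorm_mollify_indicator_sub {E : Type*} [NormedAddCommGroup E] [NormedSpace ℝ E]
    [CompleteSpace E] {p : ℝ≥0∞} (hp : 1 ≤ p) (hp' : p ≠ ⊤) (hΩ : MeasurableSet Ω)
    {h : Plane → E} (hh : MemLp h p (volume.restrict Ω)) {r : ℕ → ℝ} (hr : Tendsto r atTop (𝓝 1)) :
    Tendsto (fun k => eLpNorm
      (fun x => mollify volume (bumpSeq k) (Ω.indicator h) (r k • x) - h x) p
      (volume.restrict Ω)) atTop (𝓝 0) := by
  have hind : MemLp (Ω.indicator h) p volume := (memLp_indicator_iff_restrict hΩ).2 hh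
  have hlim := tendsto_eLpNorm_mollify_comp_smul_sub hp hp' tendsto_bumpSeq_rOut hr hind
  refine tendsto_of_tendsto_of_tendsto_of_le_of_le tendsto_const_nhds hlim
    (fun _ => zero_le) fun k => ?_
  have hae : (fun x => mollify volume (bumpSeq k) (Ω.indicator h) (r k • x) - h x)
      =ᵐ[volume.restrict Ω]
        fun x => mollify volume (bumpSeq k) (Ω.indicator h) (r k • x) - Ω.indicator h x :=
    ae_restrict_of_forall_mem hΩ fun x hx => by simp only [indicator_of_mem hx]
  exact (eLpNorm_congr_ae hae).le.trans (eLpNorm_mono_measure _ Measure.restrict_le_self)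

variable {u : Plane → ℝ} {g : Plane → Plane}

lemma IsWeakGrad.exists_contDiff_tendsto (hΩ : IsOpen Ω) (hg : IsWeakGrad Ω u g)
    (hu2 : MemLp u 2 (volume.restrict Ω)) (hg2 : MemLp g 2 (volume.restrict Ω)) :
    ∃ V : ℕ → Plane → ℝ, (∀ k, ContDiff ℝ 1 (V k)) ∧
      ∀ K ⊆ Ω, IsCompact K →
        Tendsto (fun k => eLpNorm (V k - u) 2 (volume.restrict K)) atTop (𝓝 0) ∧
        Tendsto (fun k => eLpNorm (gradient (V k) - g) 2 (volume.restrict K)) atTop (𝓝 0) := by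
  have hΩm := hΩ.measurableSet
  have hui := ((memLp_indicator_iff_restrict hΩm).2 hu2).locallyIntegrable one_le_two
  have hgi := ((memLp_indicator_iff_restrict hΩm).2 hg2).locallyIntegrable one_le_two
  have hone : Tendsto (fun _ : ℕ => (1 : ℝ)) atTop (𝓝 1) := tendsto_const_nhds
  have hlimu := tendsto_eLpNorm_mollify_indicator_sub one_le_two (by simp) hΩm hu2 hone
  have hlimg := tendsto_eLpNorm_mollify_indicator_sub one_le_two (by simp) hΩm hg2 hone
  simp only [one_smul] at hlimu hlimg
  refine ⟨fun k => mollify volume (bumpSeq k) (Ω.indicator u),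
    fun k => contDiff_mollify (n := 1) _ hui, fun K hKΩ hK => ⟨?_, ?_⟩⟩
  · exact tendsto_of_tendsto_of_tendsto_of_le_of_le tendsto_const_nhds hlimu (fun _ => zero_le)
      fun k => eLpNorm_mono_measure _ (Measure.restrict_mono hKΩ le_rfl)
  · obtain ⟨δ, hδ, hδΩ⟩ := hK.exists_cthickening_subset_open hΩ hKΩ
    refine tendsto_of_tendsto_of_tendsto_of_le_of_le' tendsto_const_nhds hlimg
      (.of_forall fun _ => zero_le) ?_
    filter_upwards [tendsto_bumpSeq_rOut.eventually_lt_const hδ] with k hk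
    refine le_of_eq_of_le (eLpNorm_congr_ae ?_)
      (eLpNorm_mono_measure _ (Measure.restrict_mono hKΩ le_rfl))
    refine ae_restrict_of_forall_mem hK.measurableSet fun x hx => ?_
    rw [Pi.sub_apply, hg.gradient_mollify_indicator hΩm hui hgi]
    exact (Metric.closedBall_subset_closedBall hk.le).trans
      ((Metric.closedBall_subset_cthickening hx δ).trans hδΩ)

lemma integral_fderiv_mul_eq_neg_integral_inner_gradient {V φ : Plane → ℝ} (hV : ContDiff ℝ 1 V)
    (hφ : ContDiff ℝ 1 φ) (hc : HasCompactSupport φ) (e : Plane) :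
    ∫ x, V x * fderiv ℝ φ x e = -∫ x, inner ℝ (gradient V x) (φ x • e) := by
  have hcont : ∀ {ψ : Plane → ℝ}, ContDiff ℝ 1 ψ → Continuous fun x => fderiv ℝ ψ x e :=
    fun hψ => (hψ.continuous_fderiv one_ne_zero).clm_apply continuous_const
  rw [integral_mul_fderiv_eq_neg_fderiv_mul_of_integrable
    (((hcont hV).mul hφ.continuous).integrable_of_hasCompactSupport hc.mul_left)
    ((hV.continuous.mul (hcont hφ)).integrable_of_hasCompactSupport (hc.fderiv_apply ℝ e).mul_left)
    ((hV.continuous.mul hφ.continuous).integrable_of_hasCompactSupport hc.mul_left)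
    (fun x _ => hV.differentiable one_ne_zero x) (fun x _ => hφ.differentiable one_ne_zero x)]
  simp only [inner_gradient_left, map_smul, smul_eq_mul, mul_comm]

lemma continuous_gradient {V : Plane → ℝ} (hV : ContDiff ℝ 1 V) : Continuous (gradient V) :=
  (InnerProductSpace.toDual ℝ Plane).symm.continuous.comp (hV.continuous_fderiv one_ne_zero)

lemma isWeakGrad_of_tendsto (hΩ : IsOpen Ω) (hu2 : MemLp u 2 (volume.restrict Ω))
    (hg2 : MemLp g 2 (volume.restrict Ω)) {V : ℕ → Plane → ℝ} (hV : ∀ k, ContDiff ℝ 1 (V k))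
    (hlim : ∀ K ⊆ Ω, IsCompact K →
      Tendsto (fun k => eLpNorm (V k - u) 2 (volume.restrict K)) atTop (𝓝 0) ∧
      Tendsto (fun k => eLpNorm (gradient (V k) - g) 2 (volume.restrict K)) atTop (𝓝 0)) :
    IsWeakGrad Ω u g := by
  refine ⟨locallyIntegrableOn_of_locallyIntegrable_restrict (hu2.locallyIntegrable one_le_two),
    locallyIntegrableOn_of_locallyIntegrable_restrict (hg2.locallyIntegrable one_le_two),
    fun φ hφ hc hs e => ?_⟩
  have hφ1 : ContDiff ℝ 1 φ := hφ.of_le (by simp)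
  set K := tsupport φ
  set ν := (volume : Measure Plane).restrict K
  have hνΩ : ν ≤ volume.restrict Ω := Measure.restrict_mono hs le_rfl
  have hφK : ∀ x ∉ K, φ x = 0 := fun x hx => image_eq_zero_of_notMem_tsupport hx
  have hdφK : ∀ x ∉ K, fderiv ℝ φ x e = 0 := fun x hx =>
    image_eq_zero_of_notMem_tsupport (f := fun x => fderiv ℝ φ x e)
      fun hx' => hx (tsupport_fderiv_apply_subset ℝ e hx')
  have hdφ : MemLp (fun x => fderiv ℝ φ x e) 2 ν := memLp_restrict_of_isBounded
    ((hφ1.continuous_fderiv one_ne_zero).clm_apply continuous_const) hc.isCompact.isBounded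
  have hφe : MemLp (fun x => φ x • e) 2 ν :=
    memLp_restrict_of_isBounded (hφ.continuous.smul continuous_const) hc.isCompact.isBounded
  obtain ⟨hlimu, hlimg⟩ := hlim K hs hc
  have hlimL := tendsto_integral_inner
    (fun k => memLp_restrict_of_isBounded (hV k).continuous hc.isCompact.isBounded)
    (hu2.mono_measure hνΩ) (fun _ => hdφ) hdφ hlimu (by simp)
  have hlimR := tendsto_integral_inner
    (fun k => memLp_restrict_of_isBounded (continuous_gradient (hV k)) hc.isCompact.isBounded)
    (hg2.mono_measure hνΩ) (fun _ => hφe) hφe hlimg (by simp)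
  have hparts : ∀ k, ∫ x, inner ℝ (V k x) (fderiv ℝ φ x e) ∂ν
      = -∫ x, inner ℝ (gradient (V k) x) (φ x • e) ∂ν := fun k => by
    rw [setIntegral_eq_integral_of_forall_compl_eq_zero fun x hx => by simp [hdφK x hx],
      setIntegral_eq_integral_of_forall_compl_eq_zero fun x hx => by simp [hφK x hx],
      ← integral_fderiv_mul_eq_neg_integral_inner_gradient (hV k) hφ1 hc e]
    simp only [RCLike.inner_apply, conj_trivial, mul_comm]
  have hlimits := tendsto_nhds_unique (hlimL.congr hparts) hlimR.neg
  rw [setIntegral_eq_of_subset_of_forall_sdiff_eq_zero hΩ.measurableSet hs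
      fun x hx => by rw [hdφK x hx.2, mul_zero],
    setIntegral_eq_of_subset_of_forall_sdiff_eq_zero hΩ.measurableSet hs
      fun x hx => by rw [hφK x hx.2, mul_zero]]
  simpa only [RCLike.inner_apply, conj_trivial, real_inner_smul_right, mul_comm] using hlimits

end Friedrichs

/-! ### Change of variables in `H¹` -/

section PullbackGrad

variable {E F : Type*} [NormedAddCommGroup E] [InnerProductSpace ℝ E] [CompleteSpace E]
  [NormedAddCommGroup F] [InnerProductSpace ℝ F] [CompleteSpace F] {T : E → F}

/-- The vector field `(DT)ᵀ (g ∘ T)`, which is the gradient of `u ∘ T` if `g` is the gradient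
of `u`. -/
noncomputable def pullbackGrad (T : E → F) (g : F → F) (x : E) : E :=
  ContinuousLinearMap.adjoint (fderiv ℝ T x) (g (T x))

lemma pullbackGrad_sub (T : E → F) (g h : F → F) :
    pullbackGrad T (g - h) = pullbackGrad T g - pullbackGrad T h :=
  funext fun _ => map_sub _ _ _

lemma gradient_comp {f : F → ℝ} (hf : Differentiable ℝ f) (hT : Differentiable ℝ T) :
    gradient (f ∘ T) = pullbackGrad T (gradient f) := by
  ext1 x
  refine ext_inner_right ℝ fun e => ?_
  rw [inner_gradient_left, pullbackGrad, ContinuousLinearMap.adjoint_inner_left,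
    inner_gradient_left, fderiv_comp x (hf _) (hT _), ContinuousLinearMap.comp_apply]

lemma nnnorm_pullbackGrad_le (g : F → F) (x : E) :
    ‖pullbackGrad T g x‖₊ ≤ ‖fderiv ℝ T x‖₊ * ‖g (T x)‖₊ := by
  refine (ContinuousLinearMap.le_opNNNorm _ _).trans_eq ?_
  rw [LinearIsometryEquiv.nnnorm_map]

end PullbackGrad

/-- `T` is an area-preserving `C¹` diffeomorphism of the plane. -/
structure IsVolumeDiffeo (T : Plane ≃ Plane) : Prop where
  contDiff : ContDiff ℝ 1 T
  contDiff_symm : ContDiff ℝ 1 T.symm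
  measurePreserving : MeasurePreserving T volume volume

namespace IsVolumeDiffeo

variable {T : Plane ≃ Plane} {Ω : Set Plane}

lemma isHomeomorph (hT : IsVolumeDiffeo T) : IsHomeomorph T :=
  (Homeomorph.mk T hT.contDiff.continuous hT.contDiff_symm.continuous).isHomeomorph

lemma measurableEmbedding (hT : IsVolumeDiffeo T) : MeasurableEmbedding T :=
  hT.isHomeomorph.isEmbedding.measurableEmbedding (by simp [T.range_eq_univ])

lemma symm (hT : IsVolumeDiffeo T) : IsVolumeDiffeo T.symm where
  contDiff := hT.contDiff_symm
  contDiff_symm := hT.contDiff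
  measurePreserving := hT.measurePreserving.symm
    ⟨T, hT.contDiff.continuous.measurable, hT.contDiff_symm.continuous.measurable⟩

lemma restrict_image (hT : IsVolumeDiffeo T) (S : Set Plane) :
    MeasurePreserving T (volume.restrict S) (volume.restrict (T '' S)) :=
  hT.measurePreserving.restrict_image_emb hT.measurableEmbedding S

lemma isBounded_image (hT : IsVolumeDiffeo T) (hΩ : Bornology.IsBounded Ω) :
    Bornology.IsBounded (T '' Ω) :=
  (hΩ.isCompact_closure.image hT.contDiff.continuous).isBounded.subset (image_mono subset_closure)

lemma eLpNorm_comp {E : Type*} [NormedAddCommGroup E] (hT : IsVolumeDiffeo T) (S : Set Plane)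
    (f : Plane → E) (p : ℝ≥0∞) :
    eLpNorm (f ∘ T) p (volume.restrict S) = eLpNorm f p (volume.restrict (T '' S)) := by
  rw [← (hT.restrict_image S).map_eq, hT.measurableEmbedding.eLpNorm_map_measure]

lemma aestronglyMeasurable_pullbackGrad (hT : IsVolumeDiffeo T) {S : Set Plane}
    {g : Plane → Plane} (hg : AEStronglyMeasurable g (volume.restrict (T '' S))) :
    AEStronglyMeasurable (pullbackGrad T g) (volume.restrict S) :=
  (ContinuousLinearMap.id ℝ (Plane →L[ℝ] Plane)).aestronglyMeasurable_comp₂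
    (ContinuousLinearMap.adjoint.continuous.comp
      (hT.contDiff.continuous_fderiv one_ne_zero)).aestronglyMeasurable
    (hg.comp_measurePreserving (hT.restrict_image S))

lemma exists_eLpNorm_pullbackGrad_le (hT : IsVolumeDiffeo T) {S : Set Plane}
    (hS : MeasurableSet S) (hb : Bornology.IsBounded S) (p : ℝ≥0∞) :
    ∃ C : ℝ≥0, ∀ g : Plane → Plane,
      eLpNorm (pullbackGrad T g) p (volume.restrict S)
        ≤ C * eLpNorm g p (volume.restrict (T '' S)) := by
  obtain ⟨C, hC⟩ := exists_norm_le_of_isBounded (hT.contDiff.continuous_fderiv one_ne_zero) hb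
  refine ⟨C.toNNReal, fun g => ?_⟩
  rw [← hT.eLpNorm_comp S g]
  refine eLpNorm_le_nnreal_smul_eLpNorm_of_ae_le_mul
    (ae_restrict_of_forall_mem hS fun x hx => (nnnorm_pullbackGrad_le g x).trans ?_) p
  gcongr
  · exact NNReal.coe_le_coe.1 ((hC x hx).trans (Real.le_coe_toNNReal C))
  · rfl

lemma memLp_pullbackGrad (hT : IsVolumeDiffeo T) {S : Set Plane} (hS : MeasurableSet S)
    (hb : Bornology.IsBounded S) {p : ℝ≥0∞} {g : Plane → Plane}
    (hg : MemLp g p (volume.restrict (T '' S))) :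
    MemLp (pullbackGrad T g) p (volume.restrict S) := by
  obtain ⟨C, hC⟩ := hT.exists_eLpNorm_pullbackGrad_le hS hb p
  exact ⟨hT.aestronglyMeasurable_pullbackGrad hg.1,
    (hC g).trans_lt (ENNReal.mul_lt_top ENNReal.coe_lt_top hg.2)⟩

lemma tendsto_eLpNorm_comp_sub (hT : IsVolumeDiffeo T) {ι : Type*} {l : Filter ι} {S : Set Plane}
    {p : ℝ≥0∞} {V : ι → Plane → ℝ} {u : Plane → ℝ}
    (hlim : Tendsto (fun i => eLpNorm (V i - u) p (volume.restrict (T '' S))) l (𝓝 0)) :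
    Tendsto (fun i => eLpNorm (V i ∘ T - u ∘ T) p (volume.restrict S)) l (𝓝 0) :=
  hlim.congr fun i => (hT.eLpNorm_comp S (V i - u) p).symm

lemma tendsto_eLpNorm_gradient_comp_sub (hT : IsVolumeDiffeo T) {ι : Type*} {l : Filter ι}
    {S : Set Plane} (hS : MeasurableSet S) (hb : Bornology.IsBounded S) {p : ℝ≥0∞}
    {V : ι → Plane → ℝ} (hV : ∀ i, Differentiable ℝ (V i)) {g : Plane → Plane}
    (hlim : Tendsto (fun i => eLpNorm (gradient (V i) - g) p (volume.restrict (T '' S))) l (𝓝 0)) :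
    Tendsto (fun i => eLpNorm (gradient (V i ∘ T) - pullbackGrad T g) p (volume.restrict S)) l
      (𝓝 0) := by
  obtain ⟨C, hC⟩ := hT.exists_eLpNorm_pullbackGrad_le hS hb p
  have hlim' := ENNReal.Tendsto.const_mul hlim (Or.inr (ENNReal.coe_ne_top (r := C)))
  rw [mul_zero] at hlim'
  refine tendsto_of_tendsto_of_tendsto_of_le_of_le tendsto_const_nhds hlim' (fun _ => zero_le)
    fun i => ?_
  rw [gradient_comp (hV i) (hT.contDiff.differentiable one_ne_zero), ← pullbackGrad_sub]
  exact hC _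

lemma isWeakGrad_comp (hT : IsVolumeDiffeo T) (hΩ : IsOpen Ω) (hb : Bornology.IsBounded Ω)
    {u : Plane → ℝ} {g : Plane → Plane} (hg : IsWeakGrad (T '' Ω) u g)
    (hu2 : MemLp u 2 (volume.restrict (T '' Ω))) (hg2 : MemLp g 2 (volume.restrict (T '' Ω))) :
    IsWeakGrad Ω (u ∘ T) (pullbackGrad T g) := by
  obtain ⟨V, hV, hlim⟩ := hg.exists_contDiff_tendsto (hT.isHomeomorph.isOpenMap _ hΩ) hu2 hg2
  refine isWeakGrad_of_tendsto hΩ (hu2.comp_measurePreserving (hT.restrict_image Ω))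
    (hT.memLp_pullbackGrad hΩ.measurableSet hb hg2) (V := fun k => V k ∘ T)
    (fun k => (hV k).comp hT.contDiff) fun K hKΩ hK => ?_
  obtain ⟨hlimu, hlimg⟩ := hlim (T '' K) (image_mono hKΩ) (hK.image hT.contDiff.continuous)
  exact ⟨hT.tendsto_eLpNorm_comp_sub hlimu, hT.tendsto_eLpNorm_gradient_comp_sub hK.measurableSet
    hK.isBounded (fun k => (hV k).differentiable one_ne_zero) hlimg⟩

section H1

variable {u : Plane → ℝ}

lemma isWeakGrad_comp_of_memH1 (hT : IsVolumeDiffeo T) (hΩ : IsOpen Ω)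
    (hb : Bornology.IsBounded Ω) (hu : MemH1 (T '' Ω) u) :
    IsWeakGrad Ω (u ∘ T) (pullbackGrad T (weakGrad (T '' Ω) u)) :=
  hT.isWeakGrad_comp hΩ hb hu.isWeakGrad hu.1
    (hu.memLp_weakGrad (hT.isHomeomorph.isOpenMap _ hΩ))

lemma memH1_comp (hT : IsVolumeDiffeo T) (hΩ : IsOpen Ω) (hb : Bornology.IsBounded Ω)
    (hu : MemH1 (T '' Ω) u) : MemH1 Ω (u ∘ T) :=
  ⟨hu.1.comp_measurePreserving (hT.restrict_image Ω), _,
    hT.memLp_pullbackGrad hΩ.measurableSet hb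
      (hu.memLp_weakGrad (hT.isHomeomorph.isOpenMap _ hΩ)),
    hT.isWeakGrad_comp_of_memH1 hΩ hb hu⟩

lemma memH1_comp_symm (hT : IsVolumeDiffeo T) (hΩ : IsOpen Ω) (hb : Bornology.IsBounded Ω)
    (hu : MemH1 Ω u) : MemH1 (T '' Ω) (u ∘ T.symm) :=
  hT.symm.memH1_comp (hT.isHomeomorph.isOpenMap _ hΩ) (hT.isBounded_image hb)
    (by rwa [T.symm_image_image])

lemma weakGrad_comp (hT : IsVolumeDiffeo T) (hΩ : IsOpen Ω) (hb : Bornology.IsBounded Ω)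
    (hu : MemH1 (T '' Ω) u) :
    weakGrad Ω (u ∘ T) =ᵐ[volume.restrict Ω] pullbackGrad T (weakGrad (T '' Ω) u) :=
  ((hT.isWeakGrad_comp_of_memH1 hΩ hb hu).ae_eq_weakGrad hΩ)

end H1

end IsVolumeDiffeo

/-! ### Traces -/

section Trace

/-- The `C¹` functions `φ i` converge to `u` in `H¹(Ω)`. -/
structure TendstoH1 {ι : Type*} (Ω : Set Plane) (φ : ι → Plane → ℝ) (l : Filter ι)
    (u : Plane → ℝ) : Prop where
  contDiff : ∀ i, ContDiff ℝ 1 (φ i)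
  tendsto : Tendsto (fun i => eLpNorm (φ i - u) 2 (volume.restrict Ω)) l (𝓝 0)
  tendsto_gradient :
    Tendsto (fun i => eLpNorm (gradient (φ i) - weakGrad Ω u) 2 (volume.restrict Ω)) l (𝓝 0)

variable {ι : Type*} {l : Filter ι} {Ω : Set Plane} {u v g h : Plane → ℝ}

lemma gradient_sub {φ ψ : Plane → ℝ} (hφ : Differentiable ℝ φ) (hψ : Differentiable ℝ ψ) :
    gradient (φ - ψ) = gradient φ - gradient ψ := by
  ext1 x
  rw [gradient, fderiv_sub (hφ x) (hψ x), map_sub, Pi.sub_apply, gradient, gradient]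

lemma TendstoH1.sub (hΩ : IsOpen Ω) (hu : MemH1 Ω u) (hv : MemH1 Ω v) {φ ψ : ι → Plane → ℝ}
    (hφ : TendstoH1 Ω φ l u) (hψ : TendstoH1 Ω ψ l v) :
    TendstoH1 Ω (fun i => φ i - ψ i) l (u - v) where
  contDiff i := (hφ.contDiff i).sub (hψ.contDiff i)
  tendsto := by
    refine (tendsto_eLpNorm_sub one_le_two
      (fun i => (hφ.contDiff i).continuous.aestronglyMeasurable.sub hu.1.1)
      (fun i => (hψ.contDiff i).continuous.aestronglyMeasurable.sub hv.1.1)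
      hφ.tendsto hψ.tendsto).congr fun i => ?_
    rw [sub_sub_sub_comm]
  tendsto_gradient := by
    refine (tendsto_eLpNorm_sub one_le_two
      (fun i => (continuous_gradient (hφ.contDiff i)).aestronglyMeasurable.sub
        (hu.memLp_weakGrad hΩ).1)
      (fun i => (continuous_gradient (hψ.contDiff i)).aestronglyMeasurable.sub
        (hv.memLp_weakGrad hΩ).1)
      hφ.tendsto_gradient hψ.tendsto_gradient).congr fun i => ?_
    rw [gradient_sub ((hφ.contDiff i).differentiable one_ne_zero)
      ((hψ.contDiff i).differentiable one_ne_zero), sub_sub_sub_comm]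
    exact eLpNorm_congr_ae (EventuallyEq.rfl.sub (hu.weakGrad_sub hΩ hv).symm)

lemma isTrace_iff : IsTrace Ω u g ↔ MemLp g 2 (bdry Ω) ∧ ∃ φ : ℕ → Plane → ℝ,
    TendstoH1 Ω φ atTop u ∧ Tendsto (fun k => eLpNorm (φ k - g) 2 (bdry Ω)) atTop (𝓝 0) :=
  ⟨fun ⟨hg, φ, hφ, hφu, hφu', hφg⟩ => ⟨hg, φ, ⟨hφ, hφu, hφu'⟩, hφg⟩,
    fun ⟨hg, φ, ⟨hφ, hφu, hφu'⟩, hφg⟩ => ⟨hg, φ, hφ, hφu, hφu', hφg⟩⟩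

lemma IsTrace.congr (hg : IsTrace Ω u g) (hgh : g =ᵐ[bdry Ω] h) : IsTrace Ω u h :=
  have ⟨hg2, φ, hφ, hφg⟩ := isTrace_iff.1 hg
  isTrace_iff.2 ⟨(memLp_congr_ae hgh).1 hg2, φ, hφ,
    hφg.congr fun _ => eLpNorm_congr_ae (EventuallyEq.rfl.sub hgh)⟩

lemma IsTrace.sub (hΩ : IsOpen Ω) (hu : MemH1 Ω u) (hv : MemH1 Ω v) (hg : IsTrace Ω u g)
    (hh : IsTrace Ω v h) : IsTrace Ω (u - v) (g - h) := by
  obtain ⟨hg2, φ, hφ, hφg⟩ := isTrace_iff.1 hg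
  obtain ⟨hh2, ψ, hψ, hψh⟩ := isTrace_iff.1 hh
  refine isTrace_iff.2 ⟨hg2.sub hh2, _, hφ.sub hΩ hu hv hψ, ?_⟩
  refine (tendsto_eLpNorm_sub one_le_two
    (fun k => (hφ.contDiff k).continuous.aestronglyMeasurable.sub hg2.1)
    (fun k => (hψ.contDiff k).continuous.aestronglyMeasurable.sub hh2.1) hφg hψh).congr
    fun k => ?_
  rw [sub_sub_sub_comm]

end Trace

namespace IsVolumeDiffeo

variable {T : Plane ≃ Plane} {Ω : Set Plane}

lemma exists_map_bdry_le (hT : IsVolumeDiffeo T) (hb : Bornology.IsBounded Ω) :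
    ∃ C : ℝ≥0, (bdry Ω).map T ≤ (C : ℝ≥0∞) • bdry (T '' Ω) := by
  obtain ⟨C, hC⟩ :=
    hT.contDiff_symm.locallyLipschitz.locallyLipschitzOn.exists_lipschitzOnWith_of_compact
      (hT.isBounded_image hb).isCompact_closure
  refine ⟨C, Measure.le_iff.2 fun A hA => ?_⟩
  have hsub : A ∩ frontier (T '' Ω) ⊆ closure (T '' Ω) :=
    inter_subset_right.trans frontier_subset_closure
  have himage : T ⁻¹' A ∩ frontier Ω = T.symm '' (A ∩ frontier (T '' Ω)) := by
    rw [T.symm.image_eq_preimage_symm, T.symm_symm, preimage_inter,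
      ← hT.isHomeomorph.image_frontier, T.preimage_image]
  have hle := (hC.mono hsub).hausdorffMeasure_image_le zero_le_one
  rw [ENNReal.rpow_one, ← himage] at hle
  rwa [Measure.map_apply hT.measurableEmbedding.measurable hA, bdry,
    Measure.restrict_apply (hT.measurableEmbedding.measurable hA), Measure.smul_apply, bdry,
    Measure.restrict_apply hA]

lemma quasiMeasurePreserving_bdry (hT : IsVolumeDiffeo T) (hb : Bornology.IsBounded Ω) :
    Measure.QuasiMeasurePreserving T (bdry Ω) (bdry (T '' Ω)) :=
  have ⟨_, hC⟩ := hT.exists_map_bdry_le hb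
  ⟨hT.measurableEmbedding.measurable, Measure.absolutelyContinuous_of_le_smul hC⟩

lemma exists_eLpNorm_comp_bdry_le (hT : IsVolumeDiffeo T) (hb : Bornology.IsBounded Ω) :
    ∃ C : ℝ≥0∞, C ≠ ⊤ ∧ ∀ f : Plane → ℝ,
      eLpNorm (f ∘ T) 2 (bdry Ω) ≤ C * eLpNorm f 2 (bdry (T '' Ω)) := by
  obtain ⟨C, hC⟩ := hT.exists_map_bdry_le hb
  refine ⟨(C : ℝ≥0∞) ^ (1 / (2 : ℝ≥0∞)).toReal, by simp, fun f => ?_⟩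
  rw [← hT.measurableEmbedding.eLpNorm_map_measure]
  exact eLpNorm_le_of_measure_le_smul hC

variable {u g : Plane → ℝ}

lemma tendstoH1_comp (hT : IsVolumeDiffeo T) (hΩ : IsOpen Ω) (hb : Bornology.IsBounded Ω)
    (hu : MemH1 (T '' Ω) u) {ι : Type*} {l : Filter ι} {φ : ι → Plane → ℝ}
    (hφ : TendstoH1 (T '' Ω) φ l u) : TendstoH1 Ω (fun i => φ i ∘ T) l (u ∘ T) where
  contDiff i := (hφ.contDiff i).comp hT.contDiff
  tendsto := hT.tendsto_eLpNorm_comp_sub hφ.tendsto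
  tendsto_gradient :=
    (hT.tendsto_eLpNorm_gradient_comp_sub hΩ.measurableSet hb
      (fun i => (hφ.contDiff i).differentiable one_ne_zero) hφ.tendsto_gradient).congr fun _ =>
        eLpNorm_congr_ae (EventuallyEq.rfl.sub (hT.weakGrad_comp hΩ hb hu).symm)

lemma isTrace_comp (hT : IsVolumeDiffeo T) (hΩ : IsOpen Ω) (hb : Bornology.IsBounded Ω)
    (hu : MemH1 (T '' Ω) u) (hg : IsTrace (T '' Ω) u g) : IsTrace Ω (u ∘ T) (g ∘ T) := by
  obtain ⟨C, hC, hle⟩ := hT.exists_eLpNorm_comp_bdry_le hb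
  obtain ⟨hg2, φ, hφ, hφg⟩ := isTrace_iff.1 hg
  have hφg' := ENNReal.Tendsto.const_mul hφg (Or.inr hC)
  rw [mul_zero] at hφg'
  exact isTrace_iff.2
    ⟨⟨hg2.1.comp_quasiMeasurePreserving (hT.quasiMeasurePreserving_bdry hb),
      (hle g).trans_lt (ENNReal.mul_lt_top hC.lt_top hg2.2)⟩, _, hT.tendstoH1_comp hΩ hb hu hφ,
    tendsto_of_tendsto_of_tendsto_of_le_of_le tendsto_const_nhds hφg' (fun _ => zero_le)
      fun k => hle (φ k - g)⟩

end IsVolumeDiffeo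

section RobinDomain

/-- `Ω` is a bounded domain with the properties of `H¹(Ω)` on which the Robin problem relies:
existence and uniqueness of traces, and the absence of nonzero functions with zero gradient and
zero trace. -/
structure IsRobinDomain (Ω : Set Plane) : Prop where
  isOpen : IsOpen Ω
  isBounded : Bornology.IsBounded Ω
  exists_isTrace : ∀ u, MemH1 Ω u → ∃ g, IsTrace Ω u g
  isTrace_unique : ∀ u g h, MemH1 Ω u → IsTrace Ω u g → IsTrace Ω u h → g =ᵐ[bdry Ω] h
  ae_eq_zero : ∀ u, MemH1 Ω u → weakGrad Ω u =ᵐ[volume.restrict Ω] 0 → IsTrace Ω u 0 →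
    u =ᵐ[volume.restrict Ω] 0

variable {Ω : Set Plane} {u v : Plane → ℝ}

namespace IsRobinDomain

lemma isTrace_trace (hΩ : IsRobinDomain Ω) (hu : MemH1 Ω u) : IsTrace Ω u (trace Ω u) := by
  have hex := hΩ.exists_isTrace u hu
  rw [trace, dif_pos hex]
  exact hex.choose_spec

lemma trace_sub (hΩ : IsRobinDomain Ω) (hu : MemH1 Ω u) (hv : MemH1 Ω v) :
    trace Ω (u - v) =ᵐ[bdry Ω] trace Ω u - trace Ω v :=
  hΩ.isTrace_unique _ _ _ (hu.sub hv) (hΩ.isTrace_trace (hu.sub hv))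
    ((hΩ.isTrace_trace hu).sub hΩ.isOpen hu hv (hΩ.isTrace_trace hv))

variable {T : Plane ≃ Plane}

lemma image (hΩ : IsRobinDomain Ω) (hT : IsVolumeDiffeo T) : IsRobinDomain (T '' Ω) where
  isOpen := hT.isHomeomorph.isOpenMap _ hΩ.isOpen
  isBounded := hT.isBounded_image hΩ.isBounded
  exists_isTrace u hu := by
    have huT := hT.memH1_comp hΩ.isOpen hΩ.isBounded hu
    obtain ⟨g, hg⟩ := hΩ.exists_isTrace _ huT
    rw [← T.symm_image_image Ω] at huT hg
    have hg' := hT.symm.isTrace_comp (hT.isHomeomorph.isOpenMap _ hΩ.isOpen)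
      (hT.isBounded_image hΩ.isBounded) huT hg
    rw [Function.comp_assoc, T.self_comp_symm, Function.comp_id] at hg'
    exact ⟨_, hg'⟩
  isTrace_unique u g h hu hg hh := by
    have hcomp : g ∘ T =ᵐ[bdry Ω] h ∘ T :=
      hΩ.isTrace_unique _ _ _ (hT.memH1_comp hΩ.isOpen hΩ.isBounded hu)
        (hT.isTrace_comp hΩ.isOpen hΩ.isBounded hu hg)
        (hT.isTrace_comp hΩ.isOpen hΩ.isBounded hu hh)
    have hqmp := hT.symm.quasiMeasurePreserving_bdry (hT.isBounded_image hΩ.isBounded)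
    rw [T.symm_image_image] at hqmp
    simpa only [Function.comp_assoc, T.self_comp_symm, Function.comp_id] using
      hqmp.ae_eq_comp hcomp
  ae_eq_zero u hu hgrad htrace := by
    have hmp := hT.restrict_image Ω
    have hgrad' : pullbackGrad T (weakGrad (T '' Ω) u) =ᵐ[volume.restrict Ω] 0 :=
      (hmp.quasiMeasurePreserving.ae_eq_comp hgrad).mono fun x hx => by
        simp only [pullbackGrad, Pi.zero_apply, Function.comp_apply] at hx ⊢
        rw [hx, map_zero]
    have hzero := hΩ.ae_eq_zero _ (hT.memH1_comp hΩ.isOpen hΩ.isBounded hu)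
      ((hT.weakGrad_comp hΩ.isOpen hΩ.isBounded hu).trans hgrad')
      (hT.isTrace_comp hΩ.isOpen hΩ.isBounded hu htrace)
    rw [Filter.EventuallyEq, ← hmp.map_eq, hT.measurableEmbedding.ae_map_iff]
    exact hzero

lemma trace_comp (hΩ : IsRobinDomain Ω) (hT : IsVolumeDiffeo T) (hu : MemH1 (T '' Ω) u) :
    trace Ω (u ∘ T) =ᵐ[bdry Ω] trace (T '' Ω) u ∘ T :=
  have huT := hT.memH1_comp hΩ.isOpen hΩ.isBounded hu
  hΩ.isTrace_unique _ _ _ huT (hΩ.isTrace_trace huT)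
    (hT.isTrace_comp hΩ.isOpen hΩ.isBounded hu ((hΩ.image hT).isTrace_trace hu))

end IsRobinDomain

end RobinDomain

/-! ### The area formula for curves -/

lemma measure_image_iUnion_of_injOn {α β ι : Type*} [TopologicalSpace α] [PolishSpace α]
    [MeasurableSpace α] [BorelSpace α] [TopologicalSpace β] [T2Space β] [MeasurableSpace β]
    [OpensMeasurableSpace β] [Countable ι] (μ : Measure β) {f : α → β} {S : ι → Set α}
    (hS : ∀ i, MeasurableSet (S i)) (hdisj : Pairwise (Function.onFun Disjoint S))
    (hf : ContinuousOn f (⋃ i, S i)) (hinj : InjOn f (⋃ i, S i)) :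
    μ (f '' ⋃ i, S i) = ∑' i, μ (f '' S i) := by
  rw [image_iUnion, measure_iUnion]
  · exact fun i j hij => (hdisj hij).image hinj (subset_iUnion S i) (subset_iUnion S j)
  · exact fun i => (hS i).image_of_continuousOn_injOn (hf.mono (subset_iUnion S i))
      (hinj.mono (subset_iUnion S i))

section Curve

variable {F : Type*} [NormedAddCommGroup F] [NormedSpace ℝ F]
  {γ γ' : ℝ → F} {A : ℝ →L[ℝ] F} {E : Set ℝ} {ε : ℝ≥0}

lemma norm_apply_one (A : ℝ →L[ℝ] F) : ‖A 1‖ = ‖A‖ := by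
  rw [← ContinuousLinearMap.norm_toSpanSingleton (𝕜 := ℝ) (A 1),
    ContinuousLinearMap.toSpanSingleton_apply_map_one]

lemma ae_norm_deriv_sub_le_of_approximatesLinearOn (hE : MeasurableSet E)
    (hA : ApproximatesLinearOn γ A E ε) (hγ : ∀ t ∈ E, HasDerivWithinAt γ (γ' t) E t) :
    ∀ᵐ t ∂volume.restrict E, ‖γ' t - A 1‖ ≤ ε := by
  have hisolated : ∀ᵐ t, t ∉ {t ∈ E | 𝓝[E ∩ Ioi t] t = ⊥} :=
    countable_setOfPred_isolated_right_within.ae_notMem volume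
  refine (ae_restrict_iff' hE).2 (hisolated.mono fun t ht htE => ?_)
  have : (𝓝[E \ {t}] t).NeBot := by
    have : (𝓝[E ∩ Ioi t] t).NeBot := ⟨fun h => ht ⟨htE, h⟩⟩
    exact this.mono (nhdsWithin_mono _ fun s hs => ⟨hs.1, hs.2.ne'⟩)
  refine le_of_tendsto ((hasDerivWithinAt_iff_tendsto_slope.1 (hγ t htE)).sub_const _).norm ?_
  filter_upwards [self_mem_nhdsWithin] with s ⟨hsE, hst⟩
  have hst0 : s - t ≠ 0 := sub_ne_zero.2 hst
  have hslope : slope γ t s - A 1 = (s - t)⁻¹ • (γ s - γ t - A (s - t)) := by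
    rw [smul_sub, ← map_smul, smul_eq_mul, inv_mul_cancel₀ hst0, slope_def_module]
  rw [hslope, norm_smul, norm_inv, inv_mul_le_iff₀ (norm_pos_iff.2 hst0), mul_comm]
  exact hA s hsE t htE

variable [MeasurableSpace F] [BorelSpace F]

lemma hausdorffMeasure_image_le_of_approximatesLinearOn (hA : ApproximatesLinearOn γ A E ε) :
    μH[1] (γ '' E) ≤ (‖A‖ₑ + ε) * volume E := by
  have := (lipschitzOnWith_iff_restrict.2 hA.lipschitz).hausdorffMeasure_image_le zero_le_one
  simpa only [ENNReal.rpow_one, hausdorffMeasure_real, ENNReal.coe_add] using! this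

lemma le_hausdorffMeasure_image_of_approximatesLinearOn (hA : ApproximatesLinearOn γ A E ε) :
    ‖A‖ₑ * volume E ≤ μH[1] (γ '' E) + ε * volume E := by
  rcases le_or_gt ‖A‖₊ ε with hε | hε
  · exact le_add_left (mul_le_mul_left (ENNReal.coe_le_coe.2 hε) _)
  have hA_anti : AntilipschitzWith ‖A‖₊⁻¹ A := A.antilipschitz_of_bound fun t => by
    have hA_ne : ‖A‖ ≠ 0 := (NNReal.coe_pos.2 (bot_le.trans_lt hε)).ne'
    have hAt : ‖A t‖ = ‖t‖ * ‖A‖ := by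
      rw [← norm_apply_one, ← norm_smul, ← map_smul, smul_eq_mul, mul_one]
    rw [hAt, NNReal.coe_inv, coe_nnnorm, mul_comm ‖t‖, inv_mul_cancel_left₀ hA_ne]
  have hγ_anti : AntilipschitzWith (‖A‖₊ - ε)⁻¹ (E.domRestrict γ) := by
    convert! (hA_anti.domRestrict E).add_lipschitzWith hA.lipschitz_sub (by rwa [inv_inv])
    · rw [inv_inv]
    · simp [domRestrict]
  have hvol : volume E ≤ (‖A‖₊ - ε : ℝ≥0)⁻¹ * μH[1] (γ '' E) := by
    have hE := (isometry_subtype_coe (s := E)).hausdorffMeasure_image (.inl zero_le_one) univ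
    have h := hγ_anti.le_hausdorffMeasure_image zero_le_one univ
    rw [image_univ, Subtype.range_coe, hausdorffMeasure_real] at hE
    rwa [← hE, ENNReal.rpow_one, image_univ, range_domRestrict] at h
  have hdiff : (‖A‖₊ - ε : ℝ≥0) ≠ 0 := (tsub_pos_of_lt hε).ne'
  calc ‖A‖ₑ * volume E = ((‖A‖₊ - ε : ℝ≥0) + ε : ℝ≥0∞) * volume E := by
        rw [← ENNReal.coe_add, tsub_add_cancel_of_le hε.le, enorm_eq_nnnorm]
    _ ≤ μH[1] (γ '' E) + ε * volume E := by
        rw [add_mul]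
        gcongr
        rwa [mul_comm, ← ENNReal.le_div_iff_mul_le (.inl (ENNReal.coe_ne_zero.2 hdiff))
          (.inl ENNReal.coe_ne_top), ENNReal.div_eq_inv_mul, ← ENNReal.coe_inv hdiff]

lemma hausdorffMeasure_image_le_lintegral_add (hE : MeasurableSet E)
    (hA : ApproximatesLinearOn γ A E ε) (hγ : ∀ t ∈ E, HasDerivWithinAt γ (γ' t) E t) :
    μH[1] (γ '' E) ≤ (∫⁻ t in E, ‖γ' t‖ₑ) + 2 * ε * volume E := by
  calc μH[1] (γ '' E) ≤ (‖A‖ₑ + ε) * volume E :=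
        hausdorffMeasure_image_le_of_approximatesLinearOn hA
    _ = ∫⁻ _ in E, (‖A‖ₑ + ε) := (setLIntegral_const _ _).symm
    _ ≤ ∫⁻ t in E, (‖γ' t‖ₑ + 2 * ε) := by
        refine lintegral_mono_ae ?_
        filter_upwards [ae_norm_deriv_sub_le_of_approximatesLinearOn hE hA hγ] with t ht
        have h : ‖A‖₊ ≤ ‖γ' t‖₊ + ε := by
          rw [← NNReal.coe_le_coe, NNReal.coe_add, coe_nnnorm, coe_nnnorm, ← norm_apply_one]
          linarith [norm_sub_norm_le (A 1) (γ' t), norm_sub_rev (A 1) (γ' t)]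
        rw [two_mul, ← add_assoc]
        gcongr
        exact ENNReal.coe_le_coe.2 h
    _ = (∫⁻ t in E, ‖γ' t‖ₑ) + 2 * ε * volume E := by
        rw [lintegral_add_right _ measurable_const, setLIntegral_const]

lemma lintegral_le_hausdorffMeasure_image_add (hE : MeasurableSet E)
    (hA : ApproximatesLinearOn γ A E ε) (hγ : ∀ t ∈ E, HasDerivWithinAt γ (γ' t) E t) :
    ∫⁻ t in E, ‖γ' t‖ₑ ≤ μH[1] (γ '' E) + 2 * ε * volume E := by
  calc ∫⁻ t in E, ‖γ' t‖ₑ ≤ ∫⁻ _ in E, (‖A‖ₑ + ε) := by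
        refine lintegral_mono_ae ?_
        filter_upwards [ae_norm_deriv_sub_le_of_approximatesLinearOn hE hA hγ] with t ht
        have h : ‖γ' t‖₊ ≤ ‖A‖₊ + ε := by
          rw [← NNReal.coe_le_coe, NNReal.coe_add, coe_nnnorm, coe_nnnorm, ← norm_apply_one]
          linarith [norm_sub_norm_le (γ' t) (A 1)]
        exact ENNReal.coe_le_coe.2 h
    _ = ‖A‖ₑ * volume E + ε * volume E := by rw [setLIntegral_const, add_mul]
    _ ≤ μH[1] (γ '' E) + ε * volume E + ε * volume E := by
        gcongr
        exact le_hausdorffMeasure_image_of_approximatesLinearOn hA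
    _ = μH[1] (γ '' E) + 2 * ε * volume E := by ring

variable [SecondCountableTopology F]

lemma hausdorffMeasure_image_eq_lintegral_of_volume_ne_top (hE : MeasurableSet E)
    (hvol : volume E ≠ ⊤) (hγ : ∀ t ∈ E, HasDerivWithinAt γ (γ' t) E t) (hinj : InjOn γ E) :
    μH[1] (γ '' E) = ∫⁻ t in E, ‖γ' t‖ₑ := by
  have hcont : ContinuousOn γ E := fun t ht => (hγ t ht).continuousWithinAt
  have hcompare (ε : ℝ≥0) (hε : ε ≠ 0) :
      μH[1] (γ '' E) ≤ (∫⁻ t in E, ‖γ' t‖ₑ) + 2 * ε * volume E ∧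
        ∫⁻ t in E, ‖γ' t‖ₑ ≤ μH[1] (γ '' E) + 2 * ε * volume E := by
    obtain ⟨S, A, hSdisj, hS, hcover, hA, -⟩ :=
      exists_partition_approximatesLinearOn_of_hasFDerivWithinAt γ E _
        (fun t ht => (hγ t ht).hasFDerivWithinAt) (fun _ => ε) (fun _ => hε)
    have hES (n) : MeasurableSet (E ∩ S n) := hE.inter (hS n)
    have hdisj : Pairwise (Function.onFun Disjoint fun n => E ∩ S n) := fun m n hmn =>
      (hSdisj hmn).mono inter_subset_right inter_subset_right
    have hunion : ⋃ n, E ∩ S n = E := by rw [← inter_iUnion, inter_eq_left.2 hcover]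
    have hγS (n) (t) (ht : t ∈ E ∩ S n) : HasDerivWithinAt γ (γ' t) (E ∩ S n) t :=
      (hγ t ht.1).mono inter_subset_left
    rw [← hunion] at hcont hinj ⊢
    rw [measure_image_iUnion_of_injOn _ hES hdisj hcont hinj, lintegral_iUnion hES hdisj,
      measure_iUnion hdisj hES, ← ENNReal.tsum_mul_left, ← ENNReal.tsum_add, ← ENNReal.tsum_add]
    exact ⟨ENNReal.tsum_le_tsum fun n =>
        hausdorffMeasure_image_le_lintegral_add (hES n) (hA n) (hγS n),
      ENNReal.tsum_le_tsum fun n =>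
        lintegral_le_hausdorffMeasure_image_add (hES n) (hA n) (hγS n)⟩
  have hsmall (η : ℝ≥0) (hη : 0 < η) : ∃ ε : ℝ≥0, ε ≠ 0 ∧ 2 * ε * volume E ≤ η := by
    obtain ⟨ε, hε, hlt⟩ := ENNReal.exists_nnreal_pos_mul_lt
      (ENNReal.mul_ne_top (ENNReal.ofNat_ne_top (n := 2)) hvol) (ENNReal.coe_ne_zero.2 hη.ne')
    exact ⟨ε, hε.ne', by rw [mul_comm 2, mul_assoc]; exact hlt.le⟩
  refine le_antisymm (ENNReal.le_of_forall_pos_le_add fun η hη _ => ?_)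
    (ENNReal.le_of_forall_pos_le_add fun η hη _ => ?_) <;>
  obtain ⟨ε, hε, hle⟩ := hsmall η hη
  exacts [(hcompare ε hε).1.trans (by gcongr), (hcompare ε hε).2.trans (by gcongr)]

lemma hausdorffMeasure_image_eq_lintegral (hE : MeasurableSet E)
    (hγ : ∀ t ∈ E, HasDerivWithinAt γ (γ' t) E t) (hinj : InjOn γ E) :
    μH[1] (γ '' E) = ∫⁻ t in E, ‖γ' t‖ₑ := by
  have hcont : ContinuousOn γ E := fun t ht => (hγ t ht).continuousWithinAt
  have hES (n : ℤ) : MeasurableSet (E ∩ Ico (n : ℝ) (n + 1)) := hE.inter measurableSet_Ico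
  have hdisj : Pairwise (Function.onFun Disjoint fun n : ℤ => E ∩ Ico (n : ℝ) (n + 1)) :=
    fun m n hmn => (pairwise_disjoint_Ico_intCast ℝ hmn).mono inter_subset_right
      inter_subset_right
  have hunion : ⋃ n : ℤ, E ∩ Ico (n : ℝ) (n + 1) = E := by
    rw [← inter_iUnion, iUnion_Ico_intCast, inter_univ]
  have hlocal (n : ℤ) : μH[1] (γ '' (E ∩ Ico (n : ℝ) (n + 1)))
      = ∫⁻ t in E ∩ Ico (n : ℝ) (n + 1), ‖γ' t‖ₑ :=
    hausdorffMeasure_image_eq_lintegral_of_volume_ne_top (hES n)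
      (measure_ne_top_of_subset inter_subset_right (by simp))
      (fun t ht => (hγ t ht.1).mono inter_subset_left) (hinj.mono inter_subset_left)
  rw [← hunion] at hcont hinj ⊢
  rw [measure_image_iUnion_of_injOn _ hES hdisj hcont hinj, lintegral_iUnion hES hdisj]
  exact tsum_congr hlocal

lemma restrict_hausdorffMeasure_image (hE : MeasurableSet E) (hγm : Measurable γ)
    (hγ : ∀ t ∈ E, HasDerivWithinAt γ (γ' t) E t) (hinj : InjOn γ E) :
    (μH[1] : Measure F).restrict (γ '' E)
      = ((volume.restrict E).withDensity fun t => ‖γ' t‖ₑ).map γ := by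
  ext S hS
  have hm : MeasurableSet (γ ⁻¹' S) := hγm hS
  rw [Measure.restrict_apply hS, Measure.map_apply hγm hS, withDensity_apply _ hm,
    Measure.restrict_restrict hm, inter_comm S, ← image_inter_preimage, inter_comm,
    hausdorffMeasure_image_eq_lintegral (hm.inter hE)
      (fun t ht => (hγ t ht.2).mono inter_subset_right) (hinj.mono inter_subset_right)]

end Curve

/-! ### The unit circle -/

section Circle

/-- The arc length parametrization of the unit circle. -/
noncomputable def circleCurve (t : ℝ) : Plane := !₂[Real.cos t, Real.sin t]

/-- Rotation by a right angle, which maps the normal of the unit circle to its tangent. -/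
noncomputable def rot (x : Plane) : Plane := !₂[-x 1, x 0]

lemma hasDerivAt_circleCurve (t : ℝ) : HasDerivAt circleCurve (rot (circleCurve t)) t := by
  have h : HasDerivAt (fun t => ![Real.cos t, Real.sin t]) ![-Real.sin t, Real.cos t] t := by
    rw [hasDerivAt_pi]
    intro i
    fin_cases i
    exacts [Real.hasDerivAt_cos t, Real.hasDerivAt_sin t]
  exact (PiLp.continuousLinearEquiv 2 ℝ fun _ : Fin 2 => ℝ).symm.toContinuousLinearMap
    |>.hasFDerivAt.comp_hasDerivAt t h

lemma continuous_circleCurve : Continuous circleCurve :=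
  continuous_iff_continuousAt.2 fun t => (hasDerivAt_circleCurve t).continuousAt

lemma norm_circleCurve (t : ℝ) : ‖circleCurve t‖ = 1 := by
  simp [EuclideanSpace.norm_eq, circleCurve]

lemma norm_rot (x : Plane) : ‖rot x‖ = ‖x‖ := by
  simp [EuclideanSpace.norm_eq, rot, add_comm]

lemma continuous_rot : Continuous rot := by
  unfold rot
  fun_prop

lemma bijOn_circleCurve :
    BijOn circleCurve (Ioc (-Real.pi) Real.pi) (Metric.sphere 0 1) := by
  have hnorm {x : Plane} (hx : x ∈ Metric.sphere 0 1) : ‖(⟨x 0, x 1⟩ : ℂ)‖ = 1 := by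
    rw [Complex.norm_eq_sqrt_sq_add_sq, ← mem_sphere_zero_iff_norm.1 hx, EuclideanSpace.norm_eq]
    simp
  refine InvOn.bijOn (f' := fun x => Complex.arg ⟨x 0, x 1⟩) ⟨fun t ht => ?_, fun x hx => ?_⟩
    (fun t _ => mem_sphere_zero_iff_norm.2 (norm_circleCurve t))
    fun x _ => ⟨Complex.neg_pi_lt_arg _, Complex.arg_le_pi _⟩
  · convert Complex.arg_cos_add_sin_mul_I ht using 2
    apply Complex.ext <;> simp [circleCurve, Complex.cos_ofReal_re, Complex.sin_ofReal_re]
  · have hne : (⟨x 0, x 1⟩ : ℂ) ≠ 0 := norm_ne_zero_iff.1 (by simp [hnorm hx])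
    ext i
    fin_cases i
    · simp [circleCurve, Complex.cos_arg hne, hnorm hx]
    · simp [circleCurve, Complex.sin_arg, hnorm hx]

lemma frontier_disk : frontier disk = Metric.sphere (0 : Plane) 1 :=
  frontier_ball _ one_ne_zero

lemma bdry_disk :
    bdry disk = (volume.restrict (Ioc (-Real.pi) Real.pi)).map circleCurve := by
  have hspeed : (fun t => ‖rot (circleCurve t)‖ₑ) = 1 := by
    funext t
    simp [← ofReal_norm, norm_rot, norm_circleCurve]
  rw [bdry, frontier_disk, ← bijOn_circleCurve.image_eq,
    restrict_hausdorffMeasure_image measurableSet_Ioc continuous_circleCurve.measurable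
      (fun t _ => (hasDerivAt_circleCurve t).hasDerivWithinAt) bijOn_circleCurve.injOn,
    hspeed, withDensity_one]

lemma ae_bdry_disk_mem_sphere : ∀ᵐ x ∂(bdry disk), x ∈ Metric.sphere (0 : Plane) 1 := by
  rw [bdry, frontier_disk]
  exact ae_restrict_mem Metric.isClosed_sphere.measurableSet

instance isFiniteMeasure_bdry_disk : IsFiniteMeasure (bdry disk) := by
  rw [bdry_disk]
  infer_instance

lemma withDensity_comp_map {α β : Type*} [MeasurableSpace α] [MeasurableSpace β]
    {μ : Measure α} {f : α → β} {d : β → ℝ≥0∞} (hf : Measurable f) (hd : Measurable d) :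
    (μ.withDensity (d ∘ f)).map f = (μ.map f).withDensity d := by
  ext S hS
  rw [Measure.map_apply hf hS, withDensity_apply _ (hf hS), withDensity_apply _ hS,
    setLIntegral_map hS hd hf]
  rfl

lemma restrict_hausdorffMeasure_image_sphere {F : Type*} [NormedAddCommGroup F] [NormedSpace ℝ F]
    [MeasurableSpace F] [BorelSpace F] [SecondCountableTopology F] {T : Plane → F}
    (hT : ContDiff ℝ 1 T) (hinj : InjOn T (Metric.sphere 0 1)) :
    (μH[1] : Measure F).restrict (T '' Metric.sphere 0 1)
      = ((bdry disk).withDensity fun x => ‖fderiv ℝ T x (rot x)‖ₑ).map T := by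
  have hd : Measurable fun x => ‖fderiv ℝ T x (rot x)‖ₑ :=
    ((hT.continuous_fderiv one_ne_zero).clm_apply continuous_rot).enorm.measurable
  have hderiv (t : ℝ) :
      HasDerivAt (T ∘ circleCurve) (fderiv ℝ T (circleCurve t) (rot (circleCurve t))) t :=
    (hT.differentiable one_ne_zero _).hasFDerivAt.comp_hasDerivAt t (hasDerivAt_circleCurve t)
  rw [← bijOn_circleCurve.image_eq] at hinj ⊢
  rw [← image_comp, restrict_hausdorffMeasure_image measurableSet_Ioc
      (hT.continuous.comp continuous_circleCurve).measurable
      (fun t _ => (hderiv t).hasDerivWithinAt) (bijOn_circleCurve.injOn.comp_iff.2 hinj),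
    ← Measure.map_map hT.continuous.measurable continuous_circleCurve.measurable, bdry_disk,
    ← withDensity_comp_map continuous_circleCurve.measurable hd]
  rfl

lemma IsVolumeDiffeo.bdry_image_disk {T : Plane ≃ Plane} (hT : IsVolumeDiffeo T) :
    bdry (T '' disk)
      = ((bdry disk).withDensity fun x => ‖fderiv ℝ T x (rot x)‖ₑ).map T := by
  rw [← restrict_hausdorffMeasure_image_sphere hT.contDiff T.injective.injOn, bdry,
    ← hT.isHomeomorph.image_frontier, frontier_disk]

end Circle

/-! ### The divergence theorem on the disk -/

section Divergence

variable {E : Type*} [NormedAddCommGroup E] [NormedSpace ℝ E]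

lemma integral_eq_integral_smul_circleCurve (f : Plane → E) :
    ∫ x, f x = ∫ p in Ioi (0 : ℝ) ×ˢ Ioo (-Real.pi) Real.pi, p.1 • f (p.1 • circleCurve p.2) := by
  let e : ℝ × ℝ ≃ᵐ Plane := MeasurableEquiv.finTwoArrow.symm.trans (MeasurableEquiv.toLp 2 _)
  have he : MeasurePreserving e :=
    (EuclideanSpace.volume_preserving_symm_measurableEquiv_toLp (Fin 2)).symm.comp
      (volume_preserving_finTwoArrow ℝ).symm
  rw [← he.integral_comp', ← integral_comp_polarCoord_symm, polarCoord_target]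
  refine setIntegral_congr_fun (measurableSet_Ioi.prod measurableSet_Ioo) fun p _ => ?_
  have hp : e (polarCoord.symm p) = p.1 • circleCurve p.2 := by
    rw [polarCoord_symm_apply]
    ext i
    fin_cases i <;> rfl
  simp only [hp]

lemma setIntegral_disk_eq_integral_smul_circleCurve (f : Plane → E) :
    ∫ x in disk, f x = ∫ p in Ioo (0 : ℝ) 1 ×ˢ Ioo (-Real.pi) Real.pi,
      p.1 • f (p.1 • circleCurve p.2) := by
  have hmem {r : ℝ} (hr : 0 < r) (θ : ℝ) : r • circleCurve θ ∈ disk ↔ r < 1 := by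
    rw [mem_ball_zero_iff, norm_smul, norm_circleCurve, mul_one, Real.norm_of_nonneg hr.le]
  rw [← integral_indicator measurableSet_ball, integral_eq_integral_smul_circleCurve]
  refine (setIntegral_eq_of_subset_of_forall_sdiff_eq_zero
    (measurableSet_Ioi.prod measurableSet_Ioo)
    (prod_mono Ioo_subset_Ioi_self Subset.rfl) ?_).trans
    (setIntegral_congr_fun (measurableSet_Ioo.prod measurableSet_Ioo) fun p hp => ?_)
  · rintro p ⟨hp, hp'⟩
    have hout : p.1 • circleCurve p.2 ∉ disk := fun h =>
      hp' ⟨⟨hp.1, (hmem hp.1 p.2).1 h⟩, hp.2⟩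
    rw [indicator_of_notMem hout, smul_zero]
  · simp only [indicator_of_mem ((hmem hp.1.1 p.2).2 hp.1.2)]

lemma setIntegral_disk_eq_integral_circle {f : Plane → E} (hf : Continuous f) :
    ∫ x in disk, f x
      = ∫ θ in Ioc (-Real.pi) Real.pi, ∫ r in (0 : ℝ)..1, r • f (r • circleCurve θ) := by
  have hcont : Continuous fun p : ℝ × ℝ => p.1 • f (p.1 • circleCurve p.2) :=
    continuous_fst.smul (hf.comp (continuous_fst.smul (continuous_circleCurve.comp continuous_snd)))
  have hint : IntegrableOn (fun p : ℝ × ℝ => p.1 • f (p.1 • circleCurve p.2))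
      (Ioo (0 : ℝ) 1 ×ˢ Ioo (-Real.pi) Real.pi) :=
    (hcont.continuousOn.integrableOn_compact (isCompact_Icc.prod isCompact_Icc)).mono_set
      (prod_mono Ioo_subset_Icc_self Ioo_subset_Icc_self)
  rw [setIntegral_disk_eq_integral_smul_circleCurve, Measure.volume_eq_prod,
    ← setIntegral_prod_swap]
  simp only [intervalIntegral.integral_of_le zero_le_one, integral_Ioc_eq_integral_Ioo]
  exact setIntegral_prod _ hint.swap

variable {ψ : Plane → E}

lemma hasDerivAt_sq_smul_comp_ray (hψ : Differentiable ℝ ψ) (ξ : Plane) (r : ℝ) :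
    HasDerivAt (fun r : ℝ => r ^ 2 • ψ (r • ξ))
      (r • ((2 : ℝ) • ψ (r • ξ) + fderiv ℝ ψ (r • ξ) (r • ξ))) r := by
  have hray : HasDerivAt (fun r : ℝ => r • ξ) ξ r := by
    simpa using (hasDerivAt_id r).smul_const ξ
  refine ((hasDerivAt_pow 2 r).smul ((hψ (r • ξ)).hasFDerivAt.comp_hasDerivAt r hray)).congr_deriv
    ?_
  simp only [map_smul, Function.comp_apply, Nat.cast_ofNat]
  module

lemma integral_bdry_disk [CompleteSpace E] (hψ : ContDiff ℝ 1 ψ) :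
    ∫ x, ψ x ∂(bdry disk) = ∫ x in disk, ((2 : ℝ) • ψ x + fderiv ℝ ψ x x) := by
  have hcont : Continuous fun x => (2 : ℝ) • ψ x + fderiv ℝ ψ x x :=
    (hψ.continuous.const_smul _).add ((hψ.continuous_fderiv one_ne_zero).clm_apply continuous_id)
  rw [setIntegral_disk_eq_integral_circle hcont, bdry_disk,
    integral_map continuous_circleCurve.aemeasurable hψ.continuous.aestronglyMeasurable]
  congr with θ
  have hray : Continuous fun r : ℝ => r • circleCurve θ := continuous_id.smul continuous_const
  rw [intervalIntegral.integral_eq_sub_of_hasDerivAt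
    (fun r _ => hasDerivAt_sq_smul_comp_ray (hψ.differentiable one_ne_zero) _ r)
    ((continuous_id.smul (hcont.comp hray)).intervalIntegrable 0 1)]
  simp

end Divergence

/-! ### The Robin problem on the disk -/

section L2

variable {α β γ E F G : Type*} {mα : MeasurableSpace α} {mβ : MeasurableSpace β}
  {mγ : MeasurableSpace γ} {μ : Measure α} {ν : Measure β} {ρ : Measure γ} [NormedAddCommGroup E]
  [NormedAddCommGroup F] [NormedAddCommGroup G] {f : α → E} {g : β → F} {h : γ → G}

lemma eLpNorm_two_sq_eq_ofReal_integral (hf : MemLp f 2 μ) :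
    eLpNorm f 2 μ ^ 2 = ENNReal.ofReal (∫ x, ‖f x‖ ^ 2 ∂μ) := by
  rw [hf.eLpNorm_eq_integral_rpow_norm two_ne_zero ENNReal.ofNat_ne_top,
    ← ENNReal.ofReal_pow (by positivity)]
  simp only [ENNReal.toReal_ofNat, Real.rpow_ofNat, ← one_div, ← Real.sqrt_eq_rpow]
  rw [Real.sq_sqrt (by positivity)]

lemma integral_norm_sq_le_of_eLpNorm_two_le (hf : MemLp f 2 μ) (hg : MemLp g 2 ν) {C : ℝ≥0}
    (hfg : eLpNorm f 2 μ ≤ C * eLpNorm g 2 ν) :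
    ∫ x, ‖f x‖ ^ 2 ∂μ ≤ C ^ 2 * ∫ x, ‖g x‖ ^ 2 ∂ν := by
  have hsq := pow_le_pow_left' hfg 2
  have hg_nonneg : 0 ≤ ∫ x, ‖g x‖ ^ 2 ∂ν := integral_nonneg fun _ => sq_nonneg _
  rw [mul_pow, eLpNorm_two_sq_eq_ofReal_integral hf, eLpNorm_two_sq_eq_ofReal_integral hg,
    ← ENNReal.ofReal_coe_nnreal, ← ENNReal.ofReal_pow C.coe_nonneg,
    ← ENNReal.ofReal_mul (by positivity)] at hsq
  exact (ENNReal.ofReal_le_ofReal_iff (by positivity)).1 hsq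

lemma eLpNorm_two_le_mul_add_of_integral_le (hf : MemLp f 2 μ) (hg : MemLp g 2 ν)
    (hh : MemLp h 2 ρ) {c : ℝ≥0}
    (hle : ∫ x, ‖f x‖ ^ 2 ∂μ ≤ c ^ 2 * ∫ x, ‖g x‖ ^ 2 ∂ν + ∫ x, ‖h x‖ ^ 2 ∂ρ) :
    eLpNorm f 2 μ ≤ c * eLpNorm g 2 ν + eLpNorm h 2 ρ := by
  rw [← ENNReal.pow_le_pow_left_iff two_ne_zero]
  calc eLpNorm f 2 μ ^ 2 ≤ c ^ 2 * eLpNorm g 2 ν ^ 2 + eLpNorm h 2 ρ ^ 2 := by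
        rw [eLpNorm_two_sq_eq_ofReal_integral hf, eLpNorm_two_sq_eq_ofReal_integral hg,
          eLpNorm_two_sq_eq_ofReal_integral hh, ← ENNReal.ofReal_coe_nnreal,
          ← ENNReal.ofReal_pow c.coe_nonneg, ← ENNReal.ofReal_mul (by positivity),
          ← ENNReal.ofReal_add (by positivity) (by positivity)]
        exact ENNReal.ofReal_le_ofReal hle
    _ ≤ (c * eLpNorm g 2 ν + eLpNorm h 2 ρ) ^ 2 := by
        rw [← mul_pow]
        exact pow_add_pow_le zero_le zero_le two_ne_zero

end L2

section DiskTrace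

variable {E : Type*} [NormedAddCommGroup E]

lemma memLp_disk {f : Plane → E} (hf : Continuous f) : MemLp f 2 (volume.restrict disk) :=
  memLp_restrict_of_isBounded hf Metric.isBounded_ball

lemma memLp_bdry_disk {f : Plane → E} (hf : Continuous f) : MemLp f 2 (bdry disk) := by
  obtain ⟨C, hC⟩ := (isCompact_sphere (0 : Plane) 1).exists_bound_of_continuousOn hf.continuousOn
  exact MemLp.of_bound hf.aestronglyMeasurable C (ae_bdry_disk_mem_sphere.mono hC)

variable {φ : Plane → ℝ}

lemma abs_two_mul_mul_fderiv_self_le (φ : Plane → ℝ) {x : Plane} (hx : x ∈ disk) :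
    |2 * (φ x * fderiv ℝ φ x x)| ≤ ‖φ x‖ ^ 2 + ‖gradient φ x‖ ^ 2 := by
  have hx1 : ‖x‖ ≤ 1 := (mem_ball_zero_iff.1 hx).le
  have hfderiv : |fderiv ℝ φ x x| ≤ ‖gradient φ x‖ := by
    rw [← inner_gradient_left]
    exact (abs_real_inner_le_norm _ _).trans (mul_le_of_le_one_right (norm_nonneg _) hx1)
  rw [abs_mul, abs_mul, abs_two, ← mul_assoc, ← Real.norm_eq_abs (φ x)]
  exact (mul_le_mul_of_nonneg_left hfderiv (by positivity)).trans (two_mul_le_add_sq _ _)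

lemma integral_bdry_disk_sq (hφ : ContDiff ℝ 1 φ) :
    ∫ x, ‖φ x‖ ^ 2 ∂bdry disk =
      2 * (∫ x in disk, ‖φ x‖ ^ 2) + ∫ x in disk, 2 * (φ x * fderiv ℝ φ x x) := by
  have hcont : Continuous fun x => 2 * (φ x * fderiv ℝ φ x x) := continuous_const.mul
    (hφ.continuous.mul ((hφ.continuous_fderiv one_ne_zero).clm_apply continuous_id))
  rw [← integral_const_mul, ← integral_add
    (((memLp_disk hφ.continuous).integrable_norm_pow two_ne_zero).const_mul 2)
    (memLp_one_iff_integrable.1 (memLp_restrict_of_isBounded hcont Metric.isBounded_ball))]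
  simp only [Real.norm_eq_abs, sq_abs]
  rw [integral_bdry_disk (hφ.pow 2)]
  refine integral_congr_ae (.of_forall fun x => ?_)
  beta_reduce
  rw [fderiv_fun_pow 2 (hφ.differentiable one_ne_zero x)]
  simp [mul_assoc]

lemma abs_integral_bdry_disk_sq_sub_le (hφ : ContDiff ℝ 1 φ) :
    |∫ x, ‖φ x‖ ^ 2 ∂bdry disk - 2 * ∫ x in disk, ‖φ x‖ ^ 2| ≤
      (∫ x in disk, ‖φ x‖ ^ 2) + ∫ x in disk, ‖gradient φ x‖ ^ 2 := by
  have hint := (memLp_disk hφ.continuous).integrable_norm_pow two_ne_zero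
  have hint' := (memLp_disk (continuous_gradient hφ)).integrable_norm_pow two_ne_zero
  have hbound : ∀ᵐ x ∂volume.restrict disk,
      ‖2 * (φ x * fderiv ℝ φ x x)‖ ≤ ‖φ x‖ ^ 2 + ‖gradient φ x‖ ^ 2 :=
    ae_restrict_of_forall_mem measurableSet_ball fun _ => abs_two_mul_mul_fderiv_self_le φ
  rw [integral_bdry_disk_sq hφ, add_sub_cancel_left, ← integral_add hint hint']
  exact norm_integral_le_of_norm_le (hint.add hint') hbound

lemma eLpNorm_bdry_disk_le (hφ : ContDiff ℝ 1 φ) :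
    eLpNorm φ 2 (bdry disk) ≤ (2 : ℝ≥0) * eLpNorm φ 2 (volume.restrict disk)
      + eLpNorm (gradient φ) 2 (volume.restrict disk) := by
  refine eLpNorm_two_le_mul_add_of_integral_le (memLp_bdry_disk hφ.continuous)
    (memLp_disk hφ.continuous) (memLp_disk (continuous_gradient hφ)) ?_
  have hpos : 0 ≤ ∫ x in disk, ‖φ x‖ ^ 2 := by positivity
  rw [NNReal.coe_ofNat]
  linarith [(abs_le.1 (abs_integral_bdry_disk_sq_sub_le hφ)).2]

lemma eLpNorm_disk_le (hφ : ContDiff ℝ 1 φ) :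
    eLpNorm φ 2 (volume.restrict disk) ≤ (1 : ℝ≥0) * eLpNorm φ 2 (bdry disk)
      + eLpNorm (gradient φ) 2 (volume.restrict disk) := by
  refine eLpNorm_two_le_mul_add_of_integral_le (memLp_disk hφ.continuous)
    (memLp_bdry_disk hφ.continuous) (memLp_disk (continuous_gradient hφ)) ?_
  rw [NNReal.coe_one]
  linarith [(abs_le.1 (abs_integral_bdry_disk_sq_sub_le hφ)).1]

variable {ι : Type*} {l : Filter ι} {u g h : Plane → ℝ}

lemma TendstoH1.tendsto_eLpNorm_bdry_disk_sub (hu : MemH1 disk u) {φ ψ : ι → Plane → ℝ}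
    (hφ : TendstoH1 disk φ l u) (hψ : TendstoH1 disk ψ l u) :
    Tendsto (fun i => eLpNorm (φ i - ψ i) 2 (bdry disk)) l (𝓝 0) := by
  have hlim := tendsto_eLpNorm_sub one_le_two
    (fun i => (hφ.contDiff i).continuous.aestronglyMeasurable.sub hu.1.1)
    (fun i => (hψ.contDiff i).continuous.aestronglyMeasurable.sub hu.1.1) hφ.tendsto hψ.tendsto
  have hgrad := (hu.memLp_weakGrad Metric.isOpen_ball).1
  have hlim' := tendsto_eLpNorm_sub one_le_two
    (fun i => (continuous_gradient (hφ.contDiff i)).aestronglyMeasurable.sub hgrad)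
    (fun i => (continuous_gradient (hψ.contDiff i)).aestronglyMeasurable.sub hgrad)
    hφ.tendsto_gradient hψ.tendsto_gradient
  simp only [sub_sub_sub_cancel_right] at hlim hlim'
  have hbound := (ENNReal.Tendsto.const_mul (a := ((2 : ℝ≥0) : ℝ≥0∞)) hlim (.inr (by simp))).add
    hlim'
  rw [mul_zero, add_zero] at hbound
  refine tendsto_of_tendsto_of_tendsto_of_le_of_le tendsto_const_nhds hbound (fun _ => zero_le)
    fun i => ?_
  beta_reduce
  rw [← gradient_sub ((hφ.contDiff i).differentiable one_ne_zero)
    ((hψ.contDiff i).differentiable one_ne_zero)]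
  exact eLpNorm_bdry_disk_le ((hφ.contDiff i).sub (hψ.contDiff i))

lemma isTrace_disk_unique (hu : MemH1 disk u) (hg : IsTrace disk u g) (hh : IsTrace disk u h) :
    g =ᵐ[bdry disk] h := by
  obtain ⟨hg2, φ, hφ, hφg⟩ := isTrace_iff.1 hg
  obtain ⟨hh2, ψ, hψ, hψh⟩ := isTrace_iff.1 hh
  have hφm k := (hφ.contDiff k).continuous.aestronglyMeasurable (μ := bdry disk)
  have hψm k := (hψ.contDiff k).continuous.aestronglyMeasurable (μ := bdry disk)
  have hlim := tendsto_eLpNorm_sub one_le_two (fun k => (hφm k).sub (hψm k))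
    (fun k => ((hφm k).sub hg2.1).sub ((hψm k).sub hh2.1))
    (hφ.tendsto_eLpNorm_bdry_disk_sub hu hψ)
    (tendsto_eLpNorm_sub one_le_two (fun k => (hφm k).sub hg2.1) (fun k => (hψm k).sub hh2.1)
      hφg hψh)
  have hdiff : ∀ k, (φ k - ψ k) - ((φ k - g) - (ψ k - h)) = g - h := fun k => by abel
  simp only [hdiff] at hlim
  have hzero := (eLpNorm_eq_zero_iff (hg2.1.sub hh2.1) two_ne_zero).1
    (tendsto_nhds_unique tendsto_const_nhds hlim)
  exact hzero.mono fun x hx => sub_eq_zero.1 hx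

lemma ae_eq_zero_of_isTrace_disk (hu : MemH1 disk u)
    (hgrad : weakGrad disk u =ᵐ[volume.restrict disk] 0) (htrace : IsTrace disk u 0) :
    u =ᵐ[volume.restrict disk] 0 := by
  obtain ⟨-, φ, hφ, hφ0⟩ := isTrace_iff.1 htrace
  have hφm k := (hφ.contDiff k).continuous.aestronglyMeasurable (μ := volume.restrict disk)
  have hgrad0 : Tendsto (fun k => eLpNorm (gradient (φ k)) 2 (volume.restrict disk)) atTop (𝓝 0) :=
    hφ.tendsto_gradient.congr fun k => eLpNorm_congr_ae (hgrad.mono fun x hx => by simp [hx])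
  have hbound := (ENNReal.Tendsto.const_mul (a := ((1 : ℝ≥0) : ℝ≥0∞)) hφ0 (.inr (by simp))).add
    hgrad0
  simp only [sub_zero, mul_zero, add_zero] at hbound
  have hlim := tendsto_eLpNorm_sub one_le_two hφm (fun k => (hφm k).sub hu.1.1)
    (tendsto_of_tendsto_of_tendsto_of_le_of_le tendsto_const_nhds hbound (fun _ => zero_le)
      fun k => eLpNorm_disk_le (hφ.contDiff k)) hφ.tendsto
  simp only [sub_sub_cancel] at hlim
  exact (eLpNorm_eq_zero_iff hu.1.1 two_ne_zero).1 (tendsto_nhds_unique tendsto_const_nhds hlim)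

end DiskTrace

section DiskApproximation

lemma tendsto_eLpNorm_smul_sub {α ι E : Type*} {mα : MeasurableSpace α} {μ : Measure α}
    [NormedAddCommGroup E] [NormedSpace ℝ E] {p : ℝ≥0∞} (hp : 1 ≤ p) {l : Filter ι} {r : ι → ℝ}
    (hr : Tendsto r l (𝓝 1)) {f : ι → α → E} {g : α → E} (hf : ∀ i, AEStronglyMeasurable (f i) μ)
    (hg : MemLp g p μ) (hlim : Tendsto (fun i => eLpNorm (f i - g) p μ) l (𝓝 0)) :
    Tendsto (fun i => eLpNorm (r i • f i - g) p μ) l (𝓝 0) := by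
  have hr' : Tendsto (fun i => ‖1 - r i‖ₑ) l (𝓝 0) := by simpa using (hr.const_sub 1).enorm
  have hlim₁ := ENNReal.Tendsto.mul hr.enorm (.inr ENNReal.zero_ne_top) hlim
    (.inr (by simp))
  have hlim₂ := ENNReal.Tendsto.mul_const hr' (.inr hg.eLpNorm_ne_top)
  simp only [mul_zero, zero_mul, ← eLpNorm_const_smul] at hlim₁ hlim₂
  refine (tendsto_eLpNorm_sub hp (fun i => ((hf i).sub hg.1).const_smul (r i))
    (fun i => hg.1.const_smul (1 - r i)) hlim₁ hlim₂).congr fun i => ?_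
  congr 1
  module

variable {u : Plane → ℝ}

lemma closedBall_smul_subset_ball {E : Type*} [NormedAddCommGroup E] [NormedSpace ℝ E] {r : ℝ}
    (hr : r < 1) {x : E} (hx : x ∈ Metric.ball 0 1) :
    Metric.closedBall ((1 - r) • x) r ⊆ Metric.ball 0 1 := by
  refine Metric.closedBall_subset_ball' ?_
  rw [dist_zero_right, norm_smul, Real.norm_of_nonneg (by linarith)]
  nlinarith [mem_ball_zero_iff.1 hx]

lemma gradient_comp_const_smul {E : Type*} [NormedAddCommGroup E] [InnerProductSpace ℝ E]
    [CompleteSpace E] (f : E → ℝ) (r : ℝ) (x : E) :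
    gradient (fun y => f (r • y)) x = r • gradient f (r • x) := by
  rw [gradient, fderiv_comp_smul, map_smul, gradient]

lemma exists_tendstoH1_disk (hu : MemH1 disk u) : ∃ φ, TendstoH1 disk φ (atTop : Filter ℕ) u := by
  have hdisk : MeasurableSet disk := measurableSet_ball
  set g := weakGrad disk u
  have hg2 : MemLp g 2 (volume.restrict disk) := hu.memLp_weakGrad Metric.isOpen_ball
  have hui := ((memLp_indicator_iff_restrict hdisk).2 hu.1).locallyIntegrable one_le_two
  have hgi := ((memLp_indicator_iff_restrict hdisk).2 hg2).locallyIntegrable one_le_two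
  set r : ℕ → ℝ := fun k => 1 - (bumpSeq k).rOut
  have hr : Tendsto r atTop (𝓝 1) := by simpa using tendsto_bumpSeq_rOut.const_sub 1
  set W : ℕ → Plane → Plane := fun k x => mollify volume (bumpSeq k) (disk.indicator g) (r k • x)
  have hW k : AEStronglyMeasurable (W k) (volume.restrict disk) :=
    ((contDiff_mollify (n := 1) _ hgi).continuous.comp
      (continuous_const_smul (r k))).aestronglyMeasurable
  have hlimW : Tendsto (fun k => eLpNorm (W k - g) 2 (volume.restrict disk)) atTop (𝓝 0) :=
    tendsto_eLpNorm_mollify_indicator_sub one_le_two (by simp) hdisk hg2 hr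
  refine ⟨fun k x => mollify volume (bumpSeq k) (disk.indicator u) (r k • x),
    fun k => (contDiff_mollify (n := 1) _ hui).comp (contDiff_const_smul _),
    tendsto_eLpNorm_mollify_indicator_sub one_le_two (by simp) hdisk hu.1 hr,
    (tendsto_eLpNorm_smul_sub one_le_two hr hW hg2 hlimW).congr' ?_⟩
  filter_upwards [tendsto_bumpSeq_rOut.eventually_lt_const one_pos] with k hk
  refine eLpNorm_congr_ae (ae_restrict_of_forall_mem hdisk fun x hx => ?_)
  rw [Pi.sub_apply, Pi.sub_apply, gradient_comp_const_smul,
    hu.isWeakGrad.gradient_mollify_indicator hdisk hui hgi _ (closedBall_smul_subset_ball hk hx),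
    Pi.smul_apply]

lemma exists_isTrace_disk (hu : MemH1 disk u) : ∃ g, IsTrace disk u g := by
  obtain ⟨φ, hφ⟩ := exists_tendstoH1_disk hu
  have hφ2 k := memLp_bdry_disk (hφ.contDiff k).continuous
  have hlim (f : ℕ × ℕ → ℕ) (hf : Tendsto f atTop atTop) :
      TendstoH1 disk (fun p => φ (f p)) atTop u :=
    ⟨fun p => hφ.contDiff (f p), hφ.tendsto.comp hf, hφ.tendsto_gradient.comp hf⟩
  have hfst : Tendsto (Prod.fst : ℕ × ℕ → ℕ) atTop atTop := by
    rw [← prod_atTop_atTop_eq]; exact tendsto_fst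
  have hsnd : Tendsto (Prod.snd : ℕ × ℕ → ℕ) atTop atTop := by
    rw [← prod_atTop_atTop_eq]; exact tendsto_snd
  have hcauchy : CauchySeq fun k => (hφ2 k).toLp (φ k) := by
    rw [cauchySeq_iff_tendsto_dist_atTop_0]
    refine ((ENNReal.tendsto_toReal ENNReal.zero_ne_top).comp
      ((hlim _ hfst).tendsto_eLpNorm_bdry_disk_sub hu (hlim _ hsnd))).congr fun p => ?_
    rw [dist_edist, Lp.edist_toLp_toLp, Function.comp_apply]
  obtain ⟨g, hg⟩ := cauchySeq_tendsto_of_complete hcauchy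
  rw [← Lp.toLp_coeFn g (Lp.memLp g)] at hg
  exact ⟨g, isTrace_iff.2
    ⟨Lp.memLp g, φ, hφ, (Lp.tendsto_Lp_iff_tendsto_eLpNorm'' φ hφ2 g (Lp.memLp g)).1 hg⟩⟩

lemma isRobinDomain_disk : IsRobinDomain disk where
  isOpen := Metric.isOpen_ball
  isBounded := Metric.isBounded_ball
  exists_isTrace _ hu := exists_isTrace_disk hu
  isTrace_unique _ _ _ := isTrace_disk_unique
  ae_eq_zero _ := ae_eq_zero_of_isTrace_disk

end DiskApproximation

/-! ### Symplectic maps -/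

section Matrix

variable {n : Type*} [Fintype n] [DecidableEq n] {A : Matrix n n ℝ}

lemma inner_toEuclideanLin_transpose (A : Matrix n n ℝ) (v w : EuclideanSpace ℝ n) :
    inner ℝ v (Matrix.toEuclideanLin Aᵀ w) = inner ℝ (Matrix.toEuclideanLin A v) w := by
  rw [← Matrix.conjTranspose_eq_transpose_of_trivial,
    Matrix.toEuclideanLin_conjTranspose_eq_adjoint, LinearMap.adjoint_inner_right]

lemma toEuclideanLin_mul_apply (A B : Matrix n n ℝ) (v : EuclideanSpace ℝ n) :
    Matrix.toEuclideanLin (A * B) v = Matrix.toEuclideanLin A (Matrix.toEuclideanLin B v) := by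
  simp [Matrix.toLpLin_apply]

lemma inner_toEuclideanLin_inv_mul_inv_transpose (hA : IsUnit A.det) (v w : EuclideanSpace ℝ n) :
    inner ℝ (Matrix.toEuclideanLin (A⁻¹ * A⁻¹ᵀ) (Matrix.toEuclideanLin Aᵀ v))
      (Matrix.toEuclideanLin Aᵀ w) = inner ℝ v w := by
  rw [inner_toEuclideanLin_transpose, ← toEuclideanLin_mul_apply, ← toEuclideanLin_mul_apply,
    Matrix.mul_nonsing_inv_cancel_left _ _ hA, ← Matrix.transpose_mul,
    Matrix.mul_nonsing_inv _ hA, Matrix.transpose_one, Matrix.toLpLin_one, LinearMap.id_apply]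

lemma toEuclideanLin_rot (A : Matrix (Fin 2) (Fin 2) ℝ) (x : Plane) :
    Matrix.toEuclideanLin A (rot x) = rot (Matrix.toEuclideanLin A.adjugateᵀ x) := by
  ext i
  fin_cases i
  · simp [Matrix.toLpLin_apply, rot, Matrix.adjugate_fin_two]
  · simp [Matrix.toLpLin_apply, rot, Matrix.adjugate_fin_two, add_comm]

end Matrix

lemma toEuclideanLin_jac (T : Plane → Plane) (x : Plane) :
    Matrix.toEuclideanLin (jac T x) = (fderiv ℝ T x : Plane →ₗ[ℝ] Plane) := by
  refine (EuclideanSpace.basisFun (Fin 2) ℝ).toBasis.ext fun j => ?_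
  ext i
  simp [jac, Matrix.toLpLin_apply]

lemma det_jac (T : Plane → Plane) (x : Plane) : (jac T x).det = (fderiv ℝ T x).det := by
  rw [ContinuousLinearMap.det, ← toEuclideanLin_jac,
    Matrix.toEuclideanLin_eq_toLin_orthonormal, LinearMap.det_toLin]

lemma pullbackGrad_eq_toEuclideanLin (T g : Plane → Plane) (x : Plane) :
    pullbackGrad T g x = Matrix.toEuclideanLin (jac T x)ᵀ (g (T x)) := by
  refine ext_inner_left ℝ fun e => ?_
  rw [pullbackGrad, ContinuousLinearMap.adjoint_inner_right, inner_toEuclideanLin_transpose,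
    toEuclideanLin_jac, ContinuousLinearMap.coe_coe]

lemma measurePreserving_of_abs_det_fderiv_eq_one {E : Type*} [NormedAddCommGroup E]
    [NormedSpace ℝ E] [FiniteDimensional ℝ E] [MeasurableSpace E] [BorelSpace E] (μ : Measure E)
    [μ.IsAddHaarMeasure] (T : E ≃ E) (hT : Differentiable ℝ T)
    (hdet : ∀ x, |(fderiv ℝ T x).det| = 1) : MeasurePreserving T μ μ := by
  have hTm := hT.continuous.measurable
  refine ⟨hTm, Measure.ext fun S hS => ?_⟩
  have harea := lintegral_abs_det_fderiv_eq_addHaar_image μ (hTm hS)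
    (fun x _ => (hT x).hasFDerivAt.hasFDerivWithinAt) T.injective.injOn
  rw [image_preimage_eq _ T.surjective] at harea
  simpa only [Measure.map_apply hTm hS, hdet, ENNReal.ofReal_one, lintegral_const, one_mul,
    Measure.restrict_apply_univ] using harea

namespace IsSymplecticMap

variable {T : Plane ≃ Plane}

lemma det_jac_eq_one (hT : IsSymplecticMap T) (x : Plane) : (jac T x).det = 1 := by
  have hentry := congrFun (congrFun (hT.symplectic x) 0) 1
  have hexpand : ((jac T x)ᵀ * !![0, 1; -1, 0] * jac T x : Matrix (Fin 2) (Fin 2) ℝ) 0 1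
      = (jac T x).det := by
    simp [Matrix.mul_apply, Fin.sum_univ_two, Matrix.det_fin_two]
    ring
  exact hexpand.symm.trans hentry

lemma isVolumeDiffeo (hT : IsSymplecticMap T) : IsVolumeDiffeo T where
  contDiff := hT.contDiff
  contDiff_symm := hT.contDiff_symm
  measurePreserving := measurePreserving_of_abs_det_fderiv_eq_one volume T
    (hT.contDiff.differentiable one_ne_zero) fun x => by
      rw [← det_jac, hT.det_jac_eq_one, abs_one]

lemma tangentialJacobian_eq (hT : IsSymplecticMap T) (x : Plane) :
    tangentialJacobian T x = ‖fderiv ℝ T x (rot x)‖ := by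
  rw [tangentialJacobian, Matrix.inv_def, hT.det_jac_eq_one, Ring.inverse_one, one_smul,
    ← norm_rot, ← toEuclideanLin_rot, toEuclideanLin_jac, ContinuousLinearMap.coe_coe]

lemma inner_metricTensor_pullbackGrad (hT : IsSymplecticMap T) (g h : Plane → Plane) (x : Plane) :
    inner ℝ (Matrix.toEuclideanLin (metricTensor T x) (pullbackGrad T g x)) (pullbackGrad T h x)
      = inner ℝ (g (T x)) (h (T x)) := by
  rw [pullbackGrad_eq_toEuclideanLin, pullbackGrad_eq_toEuclideanLin, metricTensor,
    inner_toEuclideanLin_inv_mul_inv_transpose (by simp [hT.det_jac_eq_one])]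

end IsSymplecticMap

/-! ### The Robin energy -/

section RobinForm

/-- The bilinear form `∫_Ω ∇u·∇φ + κ ∫_∂Ω u φ` of the Robin problem on `H¹(Ω)`. -/
noncomputable def robinForm (Ω : Set Plane) (κ : ℝ) (u φ : Plane → ℝ) : ℝ :=
  (∫ x in Ω, inner ℝ (weakGrad Ω u x) (weakGrad Ω φ x))
    + κ * ∫ x, trace Ω u x * trace Ω φ x ∂(bdry Ω)

/-- The energy `½ ∫_Ω |∇v|² + (κ/2) ∫_∂Ω v² - ⟨F, v⟩` of the Robin problem on `H¹(Ω)`. -/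
noncomputable def robinEnergy (Ω : Set Plane) (κ : ℝ) (F : (Plane → ℝ) → ℝ) (v : Plane → ℝ) : ℝ :=
  1 / 2 * robinForm Ω κ v v - F v

variable {Ω : Set Plane} {κ : ℝ} {u v w : Plane → ℝ}

lemma robinForm_comm (Ω : Set Plane) (κ : ℝ) (u v : Plane → ℝ) :
    robinForm Ω κ u v = robinForm Ω κ v u := by
  simp only [robinForm, real_inner_comm, mul_comm (trace Ω u _)]

lemma robinForm_self_nonneg (Ω : Set Plane) (hκ : 0 ≤ κ) (u : Plane → ℝ) :
    0 ≤ robinForm Ω κ u u :=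
  add_nonneg (integral_nonneg fun _ => real_inner_self_nonneg)
    (mul_nonneg hκ (integral_nonneg fun _ => mul_self_nonneg _))

lemma IsRobinDomain.robinForm_sub_right (hΩ : IsRobinDomain Ω) (κ : ℝ) (hu : MemH1 Ω u)
    (hv : MemH1 Ω v) (hw : MemH1 Ω w) :
    robinForm Ω κ u (v - w) = robinForm Ω κ u v - robinForm Ω κ u w := by
  have hgu := hu.memLp_weakGrad hΩ.isOpen
  have htu := (hΩ.isTrace_trace hu).1
  have hgrad : ∫ x in Ω, inner ℝ (weakGrad Ω u x) (weakGrad Ω (v - w) x)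
      = (∫ x in Ω, inner ℝ (weakGrad Ω u x) (weakGrad Ω v x))
        - ∫ x in Ω, inner ℝ (weakGrad Ω u x) (weakGrad Ω w x) := by
    rw [← integral_sub (integrable_inner hgu (hv.memLp_weakGrad hΩ.isOpen))
      (integrable_inner hgu (hw.memLp_weakGrad hΩ.isOpen))]
    exact integral_congr_ae ((hv.weakGrad_sub hΩ.isOpen hw).mono fun x hx => by
      simp only [hx, Pi.sub_apply, inner_sub_right])
  have htrace : ∫ x, trace Ω u x * trace Ω (v - w) x ∂(bdry Ω)
      = (∫ x, trace Ω u x * trace Ω v x ∂(bdry Ω))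
        - ∫ x, trace Ω u x * trace Ω w x ∂(bdry Ω) := by
    refine (integral_congr_ae ((hΩ.trace_sub hv hw).mono fun x hx => ?_)).trans
      (integral_sub (htu.integrable_mul (hΩ.isTrace_trace hv).1)
        (htu.integrable_mul (hΩ.isTrace_trace hw).1))
    simp only [hx, Pi.sub_apply, mul_sub]
  rw [robinForm, hgrad, htrace, robinForm, robinForm]
  ring

lemma IsRobinDomain.robinForm_sub_self (hΩ : IsRobinDomain Ω) (κ : ℝ) (hu : MemH1 Ω u)
    (hv : MemH1 Ω v) :
    robinForm Ω κ (u - v) (u - v)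
      = robinForm Ω κ u u - 2 * robinForm Ω κ u v + robinForm Ω κ v v := by
  have huv := hu.sub hv
  rw [hΩ.robinForm_sub_right κ huv hu hv, robinForm_comm _ _ _ u, robinForm_comm _ _ _ v,
    hΩ.robinForm_sub_right κ hu hu hv, hΩ.robinForm_sub_right κ hv hu hv, robinForm_comm _ _ v u]
  ring

lemma IsRobinDomain.ae_eq_zero_of_robinForm_self_nonpos (hΩ : IsRobinDomain Ω) (hκ : 0 < κ)
    (hu : MemH1 Ω u) (h : robinForm Ω κ u u ≤ 0) : u =ᵐ[volume.restrict Ω] 0 := by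
  have hgu := hu.memLp_weakGrad hΩ.isOpen
  have htu := hΩ.isTrace_trace hu
  have hgrad_nonneg : 0 ≤ ∫ x in Ω, inner ℝ (weakGrad Ω u x) (weakGrad Ω u x) :=
    integral_nonneg fun _ => real_inner_self_nonneg
  have htrace_nonneg : 0 ≤ κ * ∫ x, trace Ω u x * trace Ω u x ∂(bdry Ω) :=
    mul_nonneg hκ.le (integral_nonneg fun _ => mul_self_nonneg _)
  rw [robinForm] at h
  have hgrad : weakGrad Ω u =ᵐ[volume.restrict Ω] 0 :=
    ((integral_eq_zero_iff_of_nonneg (fun _ => real_inner_self_nonneg)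
      (integrable_inner hgu hgu)).1 (by linarith)).mono fun _ hx => inner_self_eq_zero.1 hx
  have htrace : trace Ω u =ᵐ[bdry Ω] 0 :=
    ((integral_eq_zero_iff_of_nonneg (fun _ => mul_self_nonneg _)
      (htu.1.integrable_mul htu.1)).1 (by nlinarith)).mono fun _ hx => mul_self_eq_zero.1 hx
  exact hΩ.ae_eq_zero u hu hgrad (htu.congr htrace)

lemma IsH1Dual.map_sub {F : (Plane → ℝ) → ℝ} (hF : IsH1Dual Ω F) (hu : MemH1 Ω u)
    (hv : MemH1 Ω v) : F (u - v) = F u - F v := by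
  have hadd := hF.map_add _ _ (hu.sub hv) hv
  rw [show (fun x => (u - v) x + v x) = u from sub_add_cancel u v] at hadd
  linarith

namespace IsRobinPoissonSolution

variable {F : (Plane → ℝ) → ℝ}

lemma robinForm_eq (hu : IsRobinPoissonSolution Ω κ F u) (hv : MemH1 Ω v) :
    robinForm Ω κ u v = F v :=
  hu.2 v hv

lemma robinEnergy_eq (hΩ : IsRobinDomain Ω) (hu : IsRobinPoissonSolution Ω κ F u)
    (hv : MemH1 Ω v) :
    robinEnergy Ω κ F v = robinEnergy Ω κ F u + 1 / 2 * robinForm Ω κ (v - u) (v - u) := by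
  rw [robinEnergy, robinEnergy, hΩ.robinForm_sub_self κ hv hu.1, robinForm_comm _ _ v u,
    hu.robinForm_eq hv, hu.robinForm_eq hu.1]
  ring

lemma robinEnergy_le (hΩ : IsRobinDomain Ω) (hκ : 0 ≤ κ) (hu : IsRobinPoissonSolution Ω κ F u)
    (hv : MemH1 Ω v) : robinEnergy Ω κ F u ≤ robinEnergy Ω κ F v := by
  rw [hu.robinEnergy_eq hΩ hv]
  linarith [robinForm_self_nonneg Ω hκ (v - u)]

lemma ae_eq_of_robinEnergy_le (hΩ : IsRobinDomain Ω) (hκ : 0 < κ)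
    (hu : IsRobinPoissonSolution Ω κ F u) (hv : MemH1 Ω v)
    (h : robinEnergy Ω κ F v ≤ robinEnergy Ω κ F u) : v =ᵐ[volume.restrict Ω] u := by
  rw [hu.robinEnergy_eq hΩ hv] at h
  exact (sub_ae_eq_zero v u).1
    (hΩ.ae_eq_zero_of_robinForm_self_nonpos hκ (hv.sub hu.1) (by linarith))

end IsRobinPoissonSolution

end RobinForm

/-! ### Transport to the reference domain -/

namespace IsVolumeDiffeo

variable {T : Plane ≃ Plane} {Ω : Set Plane}

lemma exists_memH1_comp_eq (hT : IsVolumeDiffeo T) (hΩ : IsOpen Ω) (hb : Bornology.IsBounded Ω)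
    {v : Plane → ℝ} (hv : MemH1 Ω v) : ∃ z, MemH1 (T '' Ω) z ∧ z ∘ T = v :=
  ⟨v ∘ T.symm, hT.memH1_comp_symm hΩ hb hv, by
    rw [Function.comp_assoc, T.symm_comp_self, Function.comp_id]⟩

lemma exists_h1Norm_comp_le (hT : IsVolumeDiffeo T) (hΩ : IsOpen Ω)
    (hb : Bornology.IsBounded Ω) :
    ∃ C : ℝ, ∀ u, MemH1 (T '' Ω) u → h1Norm Ω (u ∘ T) ≤ C * h1Norm (T '' Ω) u := by
  obtain ⟨C, hC⟩ := hT.exists_eLpNorm_pullbackGrad_le hΩ.measurableSet hb 2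
  refine ⟨√(1 + C ^ 2), fun u hu => ?_⟩
  have hvalue : ∫ x in Ω, (u ∘ T) x ^ 2 = ∫ y in T '' Ω, u y ^ 2 :=
    (hT.restrict_image Ω).integral_comp hT.measurableEmbedding fun y => u y ^ 2
  have hgrad : ∫ x in Ω, ‖weakGrad Ω (u ∘ T) x‖ ^ 2
      ≤ C ^ 2 * ∫ y in T '' Ω, ‖weakGrad (T '' Ω) u y‖ ^ 2 :=
    integral_norm_sq_le_of_eLpNorm_two_le ((hT.memH1_comp hΩ hb hu).memLp_weakGrad hΩ)
      (hu.memLp_weakGrad (hT.isHomeomorph.isOpenMap _ hΩ))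
      ((eLpNorm_congr_ae (hT.weakGrad_comp hΩ hb hu)).trans_le (hC _))
  have hvalue_nonneg : 0 ≤ ∫ y in T '' Ω, u y ^ 2 := integral_nonneg fun _ => sq_nonneg _
  have hgrad_nonneg : 0 ≤ ∫ y in T '' Ω, ‖weakGrad (T '' Ω) u y‖ ^ 2 :=
    integral_nonneg fun _ => sq_nonneg _
  rw [h1Norm, h1Norm, hvalue, ← Real.sqrt_mul (by positivity)]
  refine Real.sqrt_le_sqrt ?_
  nlinarith [mul_nonneg (sq_nonneg (C : ℝ)) hvalue_nonneg]

lemma isH1Dual_sourceComp (hT : IsVolumeDiffeo T) (hΩ : IsOpen Ω) (hb : Bornology.IsBounded Ω)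
    {F : (Plane → ℝ) → ℝ} (hF : IsH1Dual (T '' Ω) F) : IsH1Dual Ω (sourceComp F T) where
  map_add _ _ hu hv :=
    hF.map_add _ _ (hT.memH1_comp_symm hΩ hb hu) (hT.memH1_comp_symm hΩ hb hv)
  map_smul c _ hu := hF.map_smul c _ (hT.memH1_comp_symm hΩ hb hu)
  bound := by
    obtain ⟨C, hC⟩ := hF.bound
    obtain ⟨K, hK⟩ := hT.symm.exists_h1Norm_comp_le (hT.isHomeomorph.isOpenMap _ hΩ)
      (hT.isBounded_image hb)
    rw [T.symm_image_image] at hK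
    refine ⟨|C| * K, fun v hv => ?_⟩
    have hnorm : 0 ≤ h1Norm (T '' Ω) (v ∘ T.symm) := Real.sqrt_nonneg _
    calc |F (v ∘ T.symm)| ≤ C * h1Norm (T '' Ω) (v ∘ T.symm) := hC _ (hT.memH1_comp_symm hΩ hb hv)
      _ ≤ |C| * h1Norm (T '' Ω) (v ∘ T.symm) := mul_le_mul_of_nonneg_right (le_abs_self C) hnorm
      _ ≤ |C| * (K * h1Norm Ω v) := mul_le_mul_of_nonneg_left (hK v hv) (abs_nonneg C)
      _ = |C| * K * h1Norm Ω v := (mul_assoc _ _ _).symm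

lemma isGivenBy_sourceComp (hT : IsVolumeDiffeo T) (hΩ : IsOpen Ω) (hb : Bornology.IsBounded Ω)
    {F : (Plane → ℝ) → ℝ} {f : Plane → ℝ} (hf : IsGivenBy (T '' Ω) F f) :
    IsGivenBy Ω (sourceComp F T) (f ∘ T) := by
  intro v hv
  have hmp := hT.restrict_image Ω
  obtain ⟨z, hz, rfl⟩ := hT.exists_memH1_comp_eq hΩ hb hv
  obtain ⟨hint, hF⟩ := hf z hz
  refine ⟨(hmp.integrable_comp_emb hT.measurableEmbedding).2 hint, ?_⟩
  rw [sourceComp, Function.comp_assoc, T.self_comp_symm, Function.comp_id, hF]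
  exact (hmp.integral_comp hT.measurableEmbedding fun y => f y * z y).symm

end IsVolumeDiffeo

namespace IsSymplecticMap

variable {T : Plane ≃ Plane} {u v : Plane → ℝ}

lemma integral_inner_metricTensor_weakGrad_comp (hT : IsSymplecticMap T)
    (hu : MemH1 (T '' disk) u) (hv : MemH1 (T '' disk) v) :
    ∫ x in disk, inner ℝ (Matrix.toEuclideanLin (metricTensor T x) (weakGrad disk (u ∘ T) x))
        (weakGrad disk (v ∘ T) x)
      = ∫ y in T '' disk, inner ℝ (weakGrad (T '' disk) u y) (weakGrad (T '' disk) v y) := by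
  have hV := hT.isVolumeDiffeo
  rw [← (hV.restrict_image disk).integral_comp hV.measurableEmbedding]
  refine integral_congr_ae ?_
  filter_upwards [hV.weakGrad_comp Metric.isOpen_ball Metric.isBounded_ball hu,
    hV.weakGrad_comp Metric.isOpen_ball Metric.isBounded_ball hv] with x hux hvx
  rw [hux, hvx, hT.inner_metricTensor_pullbackGrad]

lemma integral_bdry_image_disk (hT : IsSymplecticMap T) (f : Plane → ℝ) :
    ∫ y, f y ∂(bdry (T '' disk)) = ∫ x, tangentialJacobian T x * f (T x) ∂(bdry disk) := by
  have hV := hT.isVolumeDiffeo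
  have hmeas : Measurable fun x : Plane => ‖fderiv ℝ T x (rot x)‖ₑ :=
    ((hT.contDiff.continuous_fderiv one_ne_zero).clm_apply continuous_rot).enorm.measurable
  rw [hV.bdry_image_disk, hV.measurableEmbedding.integral_map,
    integral_withDensity_eq_integral_toReal_smul hmeas (Eventually.of_forall fun _ => enorm_lt_top)]
  simp only [toReal_enorm, smul_eq_mul, hT.tangentialJacobian_eq]

lemma diskForm_comp (hT : IsSymplecticMap T) (κ : ℝ) (hu : MemH1 (T '' disk) u)
    (hv : MemH1 (T '' disk) v) : diskForm T κ (u ∘ T) (v ∘ T) = robinForm (T '' disk) κ u v := by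
  have hV := hT.isVolumeDiffeo
  rw [diskForm, robinForm, hT.integral_inner_metricTensor_weakGrad_comp hu hv,
    hT.integral_bdry_image_disk]
  congr 2
  refine integral_congr_ae ?_
  filter_upwards [isRobinDomain_disk.trace_comp hV hu, isRobinDomain_disk.trace_comp hV hv]
    with x hux hvx
  rw [hux, hvx, Function.comp_apply, Function.comp_apply]

lemma diskEnergy_comp (hT : IsSymplecticMap T) (κ : ℝ) (F : (Plane → ℝ) → ℝ)
    (hv : MemH1 (T '' disk) v) :
    diskEnergy T κ (sourceComp F T) (v ∘ T) = robinEnergy (T '' disk) κ F v := by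
  rw [robinEnergy, ← hT.diskForm_comp κ hv hv, diskEnergy, diskForm, sourceComp,
    Function.comp_assoc, T.self_comp_symm, Function.comp_id]
  simp only [sq]
  ring

end IsSymplecticMap

end RobinSymp

theorem mainTheorem3 (T : Plane ≃ Plane) (hT : IsSymplecticMap T) (κ : ℝ) (hκ : 0 ≤ κ)
    (F : (Plane → ℝ) → ℝ) (hF : IsH1Dual (T '' disk) F)
    (u : Plane → ℝ) (hu : IsRobinPoissonSolution (T '' disk) κ F u) :
    -- the transformed source `f ∘ T`, which is the composed function when `f` is a function
    IsH1Dual disk (sourceComp F T) ∧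
    (∀ f : Plane → ℝ, IsGivenBy (T '' disk) F f → IsGivenBy disk (sourceComp F T) (f ∘ T)) ∧
    -- `w = u ∘ T` is in `H¹`, attains the infimum and satisfies the variational equation
    MemH1 disk (u ∘ T) ∧
    IsDiskMinimizer T κ (sourceComp F T) (u ∘ T) ∧
    (∀ φ, MemH1 disk φ → diskForm T κ (u ∘ T) φ = sourceComp F T φ) ∧
    -- uniqueness
    (0 < κ → ∀ v, IsDiskMinimizer T κ (sourceComp F T) v →
      v =ᵐ[volume.restrict disk] u ∘ T) := by
  have hV := hT.isVolumeDiffeo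
  have hdisk : IsOpen disk := Metric.isOpen_ball
  have hbdd : Bornology.IsBounded disk := Metric.isBounded_ball
  have hΩ : IsRobinDomain (T '' disk) := isRobinDomain_disk.image hV
  have hw : MemH1 disk (u ∘ T) := hV.memH1_comp hdisk hbdd hu.1
  refine ⟨hV.isH1Dual_sourceComp hdisk hbdd hF, fun f => hV.isGivenBy_sourceComp hdisk hbdd, hw,
    ⟨hw, fun v hv => ?_⟩, fun φ hφ => ?_, fun hκ_pos v hv => ?_⟩
  · obtain ⟨z, hz, rfl⟩ := hV.exists_memH1_comp_eq hdisk hbdd hv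
    rw [hT.diskEnergy_comp κ F hz, hT.diskEnergy_comp κ F hu.1]
    exact hu.robinEnergy_le hΩ hκ hz
  · obtain ⟨z, hz, rfl⟩ := hV.exists_memH1_comp_eq hdisk hbdd hφ
    rw [hT.diskForm_comp κ hu.1 hz, hu.robinForm_eq hz, sourceComp, Function.comp_assoc,
      T.self_comp_symm, Function.comp_id]
  · obtain ⟨z, hz, rfl⟩ := hV.exists_memH1_comp_eq hdisk hbdd hv.1
    have hle := hv.2 _ hw
    rw [hT.diskEnergy_comp κ F hz, hT.diskEnergy_comp κ F hu.1] at hle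
    exact (hV.restrict_image disk).quasiMeasurePreserving.ae_eq_comp
      (hu.ae_eq_of_robinEnergy_le hΩ hκ_pos hz hle)
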